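/- Let $N\ge 0$ be an integer, $\Lambda_N=\mathbb{C}[\xi_1,\dots,\xi_N]^{S_N}$ and $m\in\mathbb{C}$. On functions of $x_1,\dots,x_N$ let $s_{ij}$ exchange $x_i$ and $x_j$, let $$D_i=\partial_i+m\sum_{j\ne i}\frac{1}{x_i-x_j}(s_{ij}-1),\qquad \pi_i=x_iD_i\qquad(1\le i\le N)$$ be the Dunkl and the Polychronakos operators, and put $$L=\sum_{i=1}^N\partial_i^2-\sum_{i<j}\frac{2m}{x_i-x_j}(\partial_i-\partial_j),\qquad \mathcal L^{\mathcal H}=L-\sum_{i=1}^N x_i\partial_i .$$ The operator $\mathcal L^{\mathcal H}$ is the (gauge-transformed) Hamiltonian of the rational Calogero--Moser system in a harmonic field. Let $\mathcal D$ be the algebra of differential operators in $x_1,\dots,x_N$ with rational coefficients whose poles lie only along the hyperplanes $x_i=x_j$. The $\pi_i$ do not commute. For $p\in\Lambda_N$, $p(\pi_1,\dots,\pi_N)$ is understood as $P(\pi_1,\dots,\pi_N)$, where $P$ is an $S_N$-invariant polynomial in non-commuting variables, not depending on $m$, of degree at most $\deg p$, that becomes $p$ when the variables commute (for example $P=\sum_i\xi_i^k$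 for $p=\sum_i\xi_i^k$). Such a $P$ exists for every $p\in\Lambda_N$, and everything below holds for every choice of such a $P$ for each $p$. For every $p\in\Lambda_N$ there is a unique $S_N$-invariant operator $\mathcal L_p\in\mathcal D$ with $\mathcal L_pf=p(\pi_1,\dots,\pi_N)f$ for all symmetric polynomials $f$ in $x_1,\dots,x_N$. With $d=\deg p$ (and $d=0$ for $p=0$), define $$\mathcal L_p^{\mathcal H}=\mathcal L_p+\frac12[\mathcal L_p,L]+\frac1{2^2\,2!}[[\mathcal L_p,L],L]+\dots+\frac1{2^d\,d!}[\cdots[\mathcal L_p,L],\dots,L],$$ the last term containing $d$ commutators. Then, for every $m\in\mathbb{C}$, $$[\mathcal L_p^{\mathcal H},\mathcal L_q^{\mathcal H}]=0\qquad\text{for all }p,q\in\Lambda_N .$$ Moreover $\mathcal L^{\mathcal H}_{\xi_1+\dots+\xi_N}=-\mathcal L^{\mathcal H}$, so the operators $\mathcal L_p^{\mathcal H}\in\mathcal D$ commute with $\mathcal L^{\mathcal H}$, that is, they are quantum integrals of the rational Calogero--Moser system in a harmonic field. The coefficients of $\mathcal L_p^{\mathcal H}$ depend polynomially on $m$: for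 each $p$ there are $C_0,\dots,C_n\in\mathcal D$, not depending on $m$, with $\mathcal L_p^{\mathcal H}=\sum_{k=0}^n m^kC_k$ for all $m\in\mathbb{C}$. -/

import Mathlib

open MvPolynomial

noncomputable section

namespace CalogeroMoser

/-- Polynomials in `x_1, …, x_N` with complex coefficients. -/
abbrev Poly (N : ℕ) : Type := MvPolynomial (Fin N) ℂ

/-- Rational functions of `x_1, …, x_N` with complex coefficients. -/
abbrev RatFun (N : ℕ) : Type := FractionRing (Poly N)

/-- Linear operators on the field of rational functions. Differential operators with rational
coefficients act faithfully on it, so an identity between differential operators is the same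
thing as the identity between these linear maps. -/
abbrev Op (N : ℕ) : Type := Module.End ℂ (RatFun N)

variable {N : ℕ}

/-- The partial derivative `∂_i` of a rational function, by the quotient rule. -/
def ratDerivFun (i : Fin N) (f : RatFun N) : RatFun N :=
  let a : Poly N := (IsLocalization.sec (nonZeroDivisors (Poly N)) f).1
  let b : Poly N := (IsLocalization.sec (nonZeroDivisors (Poly N)) f).2
  (algebraMap (Poly N) (RatFun N) (pderiv i a) * algebraMap (Poly N) (RatFun N) b
    - algebraMap (Poly N) (RatFun N) a * algebraMap (Poly N) (RatFun N) (pderiv i b))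
    / algebraMap (Poly N) (RatFun N) b ^ 2

theorem ratDerivFun_div (i : Fin N) (a b : Poly N) (hb : b ≠ 0) :
    ratDerivFun i (algebraMap (Poly N) (RatFun N) a / algebraMap (Poly N) (RatFun N) b) =
      (algebraMap (Poly N) (RatFun N) (pderiv i a) * algebraMap (Poly N) (RatFun N) b
        - algebraMap (Poly N) (RatFun N) a * algebraMap (Poly N) (RatFun N) (pderiv i b))
        / algebraMap (Poly N) (RatFun N) b ^ 2 := by
  set f : RatFun N := algebraMap (Poly N) (RatFun N) a / algebraMap (Poly N) (RatFun N) b with hf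
  have hinj := IsFractionRing.injective (Poly N) (RatFun N)
  have hsec := IsLocalization.sec_spec (nonZeroDivisors (Poly N)) f
  unfold ratDerivFun
  set c : Poly N := (IsLocalization.sec (nonZeroDivisors (Poly N)) f).1
  set d : Poly N := (IsLocalization.sec (nonZeroDivisors (Poly N)) f).2.1 with hd
  have hd0 : d ≠ 0 := nonZeroDivisors.coe_ne_zero _
  have hb' : algebraMap (Poly N) (RatFun N) b ≠ 0 := by
    simpa using hinj.ne hb
  have hd' : algebraMap (Poly N) (RatFun N) d ≠ 0 := by
    simpa using hinj.ne hd0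
  have h1 : a * d = c * b := by
    apply hinj
    rw [map_mul, map_mul, ← hsec, hf]
    field_simp
  have h2 : a * pderiv i d + d * pderiv i a = c * pderiv i b + b * pderiv i c := by
    have := congrArg (pderiv i) h1
    simpa [Derivation.leibniz] using this
  have h1' := congrArg (algebraMap (Poly N) (RatFun N)) h1
  have h2' := congrArg (algebraMap (Poly N) (RatFun N)) h2
  simp only [map_mul, map_add] at h1' h2'
  simp only []
  rw [div_eq_div_iff (pow_ne_zero 2 hd') (pow_ne_zero 2 hb')]
  linear_combination (algebraMap (Poly N) (RatFun N) (pderiv i b) *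
      algebraMap (Poly N) (RatFun N) d + algebraMap (Poly N) (RatFun N) b *
      algebraMap (Poly N) (RatFun N) (pderiv i d)) * h1'
      - (algebraMap (Poly N) (RatFun N) b * algebraMap (Poly N) (RatFun N) d) * h2'

/-- The partial derivative `∂_i` as a linear operator on rational functions. -/
def partialD (i : Fin N) : Op N where
  toFun := ratDerivFun i
  map_add' f g := by
    obtain ⟨a, b, hb, rfl⟩ := IsFractionRing.div_surjective (Poly N) f
    obtain ⟨c, d, hd, rfl⟩ := IsFractionRing.div_surjective (Poly N) g
    have hb0 := nonZeroDivisors.ne_zero hb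
    have hd0 := nonZeroDivisors.ne_zero hd
    have hb' : algebraMap (Poly N) (RatFun N) b ≠ 0 := by
      simpa using (IsFractionRing.injective (Poly N) (RatFun N)).ne hb0
    have hd' : algebraMap (Poly N) (RatFun N) d ≠ 0 := by
      simpa using (IsFractionRing.injective (Poly N) (RatFun N)).ne hd0
    rw [div_add_div _ _ hb' hd', ← map_mul, ← map_mul, ← map_mul, ← map_add,
      ratDerivFun_div i _ _ (mul_ne_zero hb0 hd0), ratDerivFun_div i _ _ hb0,
      ratDerivFun_div i _ _ hd0]
    simp only [Derivation.leibniz, map_add, map_mul, smul_eq_mul]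
    field_simp
    ring
  map_smul' r f := by
    obtain ⟨a, b, hb, rfl⟩ := IsFractionRing.div_surjective (Poly N) f
    have hb0 := nonZeroDivisors.ne_zero hb
    have e : r • (algebraMap (Poly N) (RatFun N) a / algebraMap (Poly N) (RatFun N) b) =
        algebraMap (Poly N) (RatFun N) (C r * a) / algebraMap (Poly N) (RatFun N) b := by
      rw [Algebra.smul_def, IsScalarTower.algebraMap_apply ℂ (Poly N) (RatFun N), map_mul,
        mul_div_assoc]
      rfl
    rw [e, ratDerivFun_div i _ _ hb0, ratDerivFun_div i _ _ hb0, RingHom.id_apply,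
      Algebra.smul_def, IsScalarTower.algebraMap_apply ℂ (Poly N) (RatFun N)]
    simp only [pderiv_C_mul, map_mul, MvPolynomial.algebraMap_eq]
    ring

/-- The coordinate function `x_i`. -/
def coord (i : Fin N) : RatFun N := algebraMap (Poly N) (RatFun N) (X i)

/-- The operator of multiplication by a rational function. -/
def mulOp (f : RatFun N) : Op N := LinearMap.mulLeft ℂ f

/-- A permutation acting on rational functions by permuting the variables. -/
def permOp (σ : Equiv.Perm (Fin N)) : Op N :=
  (IsFractionRing.algEquivOfAlgEquiv (K := RatFun N) (L := RatFun N)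
    (renameEquiv ℂ σ)).toLinearMap

/-- The algebra of differential operators whose coefficients are rational functions with poles
only along the hyperplanes `x_i = x_j`. -/
def diffOps (N : ℕ) : Subalgebra ℂ (Op N) :=
  Algebra.adjoin ℂ
    (Set.range (fun i : Fin N => mulOp (coord i)) ∪
      {A | ∃ i j : Fin N, i ≠ j ∧ A = mulOp (coord i - coord j)⁻¹} ∪
      Set.range (fun i : Fin N => partialD i))

/-- The Dunkl operator `D_i = ∂_i + m ∑_{j ≠ i} (x_i - x_j)⁻¹ (s_{ij} - 1)`. -/
def dunkl (m : ℂ) (i : Fin N) : Op N :=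
  partialD i + m • ∑ j ∈ Finset.univ.erase i,
    mulOp (coord i - coord j)⁻¹ * (permOp (Equiv.swap i j) - 1)

/-- The Polychronakos operator `π_i = x_i D_i`. -/
def polychronakos (m : ℂ) (i : Fin N) : Op N := mulOp (coord i) * dunkl m i

/-- `P` is a way of writing the polynomial `p(ξ_1, …, ξ_N)` in non-commuting variables which is
invariant under permutations of the variables and does not raise the degree. -/
structure IsSymmetricOrdering (p : Poly N) (P : FreeAlgebra ℂ (Fin N)) : Prop where
  invariant : ∀ σ : Equiv.Perm (Fin N),
    FreeAlgebra.lift ℂ (fun i => FreeAlgebra.ι ℂ (σ i)) P = P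
  commutative_image : FreeAlgebra.lift ℂ (fun i => (X i : Poly N)) P = p
  degree_le : P ∈ Submodule.span ℂ
    {w | ∃ l : List (Fin N), l.length ≤ p.totalDegree ∧ w = (l.map (FreeAlgebra.ι ℂ)).prod}

/-- `T` is the operator `ℒ_p`: the `S_N`-invariant differential operator which acts on symmetric
polynomials as `p(π_1, …, π_N)`, the latter being read through the ordering `P` of `p`. -/
structure IsTrigIntegral (m : ℂ) (P : FreeAlgebra ℂ (Fin N)) (T : Op N) : Prop where
  mem_diffOps : T ∈ diffOps N
  invariant : ∀ σ : Equiv.Perm (Fin N), permOp σ * T = T * permOp σ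
  apply_symmetric : ∀ f : Poly N, f.IsSymmetric →
    T (algebraMap (Poly N) (RatFun N) f) =
      FreeAlgebra.lift ℂ (polychronakos m) P (algebraMap (Poly N) (RatFun N) f)

/-- The rational operator `L = Δ - ∑_{i<j} 2m / (x_i - x_j) (∂_i - ∂_j)`. -/
def rationalCM (N : ℕ) (m : ℂ) : Op N :=
  ∑ i, partialD i ^ 2 -
    ∑ i, ∑ j ∈ Finset.Ioi i,
      (2 * m) • (mulOp (coord i - coord j)⁻¹ * (partialD i - partialD j))

/-- The operator of the rational system in a harmonic field, `L - ∑ x_i ∂_i`. -/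
def harmonicCM (N : ℕ) (m : ℂ) : Op N :=
  rationalCM N m - ∑ i, mulOp (coord i) * partialD i

/-- The series `∑_{k=0}^d (2^k k!)⁻¹ [⋯[[T, L], L], ⋯, L]` with `k` commutators in the `k`-th
term. -/
def harmonicSeries (m : ℂ) (d : ℕ) (T : Op N) : Op N :=
  ∑ k ∈ Finset.range (d + 1),
    ((2 : ℂ) ^ k * (k.factorial : ℂ))⁻¹ • (fun A : Op N => ⁅A, rationalCM N m⁆)^[k] T

end CalogeroMoser

end

noncomputable section

namespace CalogeroMoser

variable {N : ℕ}

/-! Write `H = ∑ D_i²`. The Dunkl operators commute and `[H, x_i] = 2 D_i`, so `[π_i, H]/2 = -D_i²`,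
while `D_i²` commutes with `H`. Formally, the exponential of `T ↦ [T, H]/2` is then an algebra
homomorphism sending `π_i` to `h_i = π_i - D_i² = (x_i - D_i) D_i`. Truncated after `d` commutators
it is still exact on words of length at most `d`, which is why an ordering must not exceed the
degree. On invariant functions `H` acts as `L`, so `ℒ_p^H` acts there as `P(h_1, …, h_N)`.

The operators `x_i - D_i` commute with one another and, for `i ≠ j`, have the same brackets with
`D_j` as the `x_i`. Hence the `h_i` obey degenerate affine Hecke relations: permutations permute
them and `[h_i, h_j] = m s_ij (h_j - h_i)`. Between two copies of the symmetrizer a word in the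
`h_i` equals its reversal, because exchanging neighbouring letters changes both by the same amount.
Reversal is thus an antihomomorphism that is trivial on invariant elements acting on invariants, and
this forces `P(h)` and `Q(h)` to commute there.

A differential operator is determined by its values on symmetric polynomials (`diffOps_ext`), so
identities on invariants become identities of operators. Commutation with the Hamiltonian is the
case `q = ξ_1 + ⋯ + ξ_N`. Polynomial dependence on `m` comes from building `ℒ_p` letter by letter
inside an algebra of polynomial families. -/

/-! ### Multiplications, derivatives and permutations of rational functions -/

theorem mulOp_apply (f g : RatFun N) : mulOp f g = f * g := rfl

theorem mulOp_mul (f g : RatFun N) : mulOp (f * g) = mulOp f * mulOp g := by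
  ext x; simp [mulOp_apply, mul_assoc]

theorem mulOp_comm (f g : RatFun N) : mulOp f * mulOp g = mulOp g * mulOp f := by
  rw [← mulOp_mul, ← mulOp_mul, mul_comm]

theorem mulOp_one : mulOp (1 : RatFun N) = 1 := by
  ext x; simp [mulOp_apply]

theorem algebraMap_poly_ne_zero {b : Poly N} (hb : b ≠ 0) :
    algebraMap (Poly N) (RatFun N) b ≠ 0 := by
  simpa using (IsFractionRing.injective (Poly N) (RatFun N)).ne hb

theorem partialD_mul (i : Fin N) (f g : RatFun N) :
    partialD i (f * g) = f * partialD i g + g * partialD i f := by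
  obtain ⟨a, b, hb, rfl⟩ := IsFractionRing.div_surjective (Poly N) f
  obtain ⟨c, d, hd, rfl⟩ := IsFractionRing.div_surjective (Poly N) g
  have hb0 := nonZeroDivisors.ne_zero hb
  have hd0 := nonZeroDivisors.ne_zero hd
  have hb' := algebraMap_poly_ne_zero hb0
  have hd' := algebraMap_poly_ne_zero hd0
  change ratDerivFun i _ = _ * ratDerivFun i _ + _ * ratDerivFun i _
  rw [div_mul_div_comm, ← map_mul, ← map_mul,
    ratDerivFun_div i _ _ (mul_ne_zero hb0 hd0), ratDerivFun_div i _ _ hb0,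
    ratDerivFun_div i _ _ hd0]
  simp only [Derivation.leibniz, map_add, map_mul, smul_eq_mul]
  field_simp
  ring

theorem partialD_algebraMap (i : Fin N) (a : Poly N) :
    partialD i (algebraMap (Poly N) (RatFun N) a) = algebraMap _ _ (pderiv i a) := by
  have := ratDerivFun_div i a 1 one_ne_zero
  change ratDerivFun i _ = _
  simpa using this

theorem partialD_one (i : Fin N) : partialD i (1 : RatFun N) = 0 := by
  simpa using partialD_algebraMap i 1

theorem partialD_coord_self (i : Fin N) : partialD i (coord i) = 1 := by
  simp [coord, partialD_algebraMap]

theorem partialD_coord_of_ne {i j : Fin N} (h : j ≠ i) : partialD i (coord j) = 0 := by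
  simp [coord, partialD_algebraMap, pderiv_X_of_ne h]

theorem permOp_mul_apply (σ : Equiv.Perm (Fin N)) (f g : RatFun N) :
    permOp σ (f * g) = permOp σ f * permOp σ g := by
  simp [permOp]

theorem permOp_apply_one (σ : Equiv.Perm (Fin N)) : permOp σ (1 : RatFun N) = 1 := by
  simp [permOp]

theorem permOp_inv_apply (σ : Equiv.Perm (Fin N)) (f : RatFun N) :
    permOp σ f⁻¹ = (permOp σ f)⁻¹ := by
  simp [permOp]

theorem permOp_algebraMap (σ : Equiv.Perm (Fin N)) (p : Poly N) :
    permOp σ (algebraMap (Poly N) (RatFun N) p) = algebraMap _ _ (rename σ p) := by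
  simp [permOp]

theorem permOp_coord (σ : Equiv.Perm (Fin N)) (i : Fin N) :
    permOp σ (coord i) = coord (σ i) := by
  simp [coord, permOp_algebraMap]

theorem permOp_mul_mulOp (σ : Equiv.Perm (Fin N)) (f : RatFun N) :
    permOp σ * mulOp f = mulOp (permOp σ f) * permOp σ := by
  ext x; simp [mulOp_apply, permOp_mul_apply]

/-- An operator that commutes with all coordinates and annihilates the constants is zero. -/
theorem eq_zero_of_commute_coord {A : Op N} (hA : ∀ k, A * mulOp (coord k) = mulOp (coord k) * A)
    (h1 : A 1 = 0) : A = 0 := by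
  have hp : ∀ (p : Poly N) (f : RatFun N),
      A (algebraMap _ _ p * f) = algebraMap _ _ p * A f := by
    intro p
    induction p using MvPolynomial.induction_on with
    | C a =>
      intro f
      have e : algebraMap (Poly N) (RatFun N) (C a) = algebraMap ℂ (RatFun N) a := by
        rw [IsScalarTower.algebraMap_apply ℂ (Poly N) (RatFun N)]; rfl
      rw [e, ← Algebra.smul_def, ← Algebra.smul_def, map_smul]
    | add p q hp hq => intro f; simp [add_mul, hp, hq]
    | mul_X p i hp =>
      intro f
      rw [map_mul (algebraMap (Poly N) (RatFun N)), mul_assoc, hp]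
      have := LinearMap.congr_fun (hA i) f
      simp only [Module.End.mul_apply, mulOp_apply, coord] at this
      rw [this, mul_assoc]
  ext f
  obtain ⟨a, b, hb, rfl⟩ := IsFractionRing.div_surjective (Poly N) f
  have hb' := algebraMap_poly_ne_zero (nonZeroDivisors.ne_zero hb)
  -- Linearity over polynomials gives `b A(a/b) = A(a) = a A(1) = 0`.
  have h := hp b (algebraMap _ _ a / algebraMap _ _ b)
  rw [mul_div_cancel₀ _ hb', ← mul_one (algebraMap _ (RatFun N) a), hp a, h1, mul_zero,
    mul_one] at h
  simpa [hb'] using h.symm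

theorem permOp_one : permOp (1 : Equiv.Perm (Fin N)) = 1 := by
  rw [← sub_eq_zero]
  refine eq_zero_of_commute_coord (fun k => ?_) (by simp [permOp_apply_one])
  rw [sub_mul, mul_sub, permOp_mul_mulOp, permOp_coord]
  simp

theorem permOp_mul (σ τ : Equiv.Perm (Fin N)) : permOp (σ * τ) = permOp σ * permOp τ := by
  ext f
  obtain ⟨a, b, hb, rfl⟩ := IsFractionRing.div_surjective (Poly N) f
  simp only [div_eq_mul_inv, Module.End.mul_apply, permOp_mul_apply, permOp_inv_apply,
    permOp_algebraMap, rename_rename]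
  rfl

theorem permOp_mul_inv (σ : Equiv.Perm (Fin N)) : permOp σ * permOp σ⁻¹ = 1 := by
  rw [← permOp_mul, mul_inv_cancel, permOp_one]

theorem permOp_inv_mul (σ : Equiv.Perm (Fin N)) : permOp σ⁻¹ * permOp σ = 1 := by
  rw [← permOp_mul, inv_mul_cancel, permOp_one]

theorem partialD_mul_mulOp (i : Fin N) (f : RatFun N) :
    partialD i * mulOp f = mulOp f * partialD i + mulOp (partialD i f) := by
  ext x; simp [mulOp_apply, partialD_mul, mul_comm]

/-- The operators `σ ∂_i σ⁻¹` and `∂_{σ i}` have the same commutators with all coordinates and both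
kill 1, so their difference vanishes. -/
theorem permOp_mul_partialD (σ : Equiv.Perm (Fin N)) (i : Fin N) :
    permOp σ * partialD i = partialD (σ i) * permOp σ := by
  suffices h : permOp σ * partialD i * permOp σ⁻¹ - partialD (σ i) = 0 by
    rw [sub_eq_zero] at h
    rw [← h, mul_assoc, permOp_inv_mul, mul_one]
  refine eq_zero_of_commute_coord (fun k => ?_) ?_
  · have h1 : permOp σ * partialD i * permOp σ⁻¹ * mulOp (coord k) =
        mulOp (coord k) * (permOp σ * partialD i * permOp σ⁻¹)
          + mulOp (permOp σ (partialD i (coord (σ⁻¹ k)))) := by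
      rw [mul_assoc, permOp_mul_mulOp, permOp_coord, ← mul_assoc, mul_assoc (permOp σ),
        partialD_mul_mulOp, mul_add, add_mul, ← mul_assoc, permOp_mul_mulOp, permOp_coord,
        permOp_mul_mulOp, mul_assoc _ (permOp σ) (permOp σ⁻¹), permOp_mul_inv]
      simp [mul_assoc]
    rw [sub_mul, mul_sub, h1, partialD_mul_mulOp]
    have h2 : permOp σ (partialD i (coord (σ⁻¹ k))) = partialD (σ i) (coord k) := by
      by_cases hk : k = σ i
      · subst hk; simp [partialD_coord_self, permOp_apply_one]
      · rw [partialD_coord_of_ne hk, partialD_coord_of_ne, map_zero]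
        rintro h; apply hk; rw [← h]; simp
    rw [h2]; abel
  · simp [permOp_apply_one, partialD_one]

theorem coord_sub_ne_zero {i j : Fin N} (h : i ≠ j) : (coord i - coord j : RatFun N) ≠ 0 := by
  rw [sub_ne_zero]
  intro he
  exact h (X_injective (IsFractionRing.injective (Poly N) (RatFun N) he))

theorem permOp_mul_swap (σ : Equiv.Perm (Fin N)) (i j : Fin N) :
    permOp σ * permOp (Equiv.swap i j) = permOp (Equiv.swap (σ i) (σ j)) * permOp σ := by
  rw [← permOp_mul, ← permOp_mul, Equiv.mul_swap_eq_swap_mul]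

/-! ### Relations of the Dunkl operators -/

theorem permOp_mul_dunkl (m : ℂ) (σ : Equiv.Perm (Fin N)) (i : Fin N) :
    permOp σ * dunkl m i = dunkl m (σ i) * permOp σ := by
  unfold dunkl
  rw [mul_add, add_mul, permOp_mul_partialD, mul_smul_comm, smul_mul_assoc, Finset.mul_sum,
    Finset.sum_mul]
  congr 2
  refine Finset.sum_equiv σ (by simp) (fun j _ => ?_)
  rw [← mul_assoc, permOp_mul_mulOp, permOp_inv_apply, map_sub, permOp_coord, permOp_coord,
    mul_assoc, mul_assoc, mul_sub, sub_mul, permOp_mul_swap, mul_one, one_mul]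

/-- The commutator of the Dunkl operator `D_i` with the coordinate `x_k`. -/
def dunklCoordComm (m : ℂ) (i k : Fin N) : Op N :=
  if i = k then 1 - m • ∑ l ∈ Finset.univ.erase i, permOp (Equiv.swap i l)
  else m • permOp (Equiv.swap i k)

theorem dunklCoordComm_self (m : ℂ) (i : Fin N) :
    dunklCoordComm m i i = 1 - m • ∑ l ∈ Finset.univ.erase i, permOp (Equiv.swap i l) :=
  if_pos rfl

theorem dunklCoordComm_of_ne (m : ℂ) {i k : Fin N} (h : i ≠ k) :
    dunklCoordComm m i k = m • permOp (Equiv.swap i k) :=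
  if_neg h

theorem exchange_mul_coord (i j k : Fin N) :
    mulOp (coord i - coord j)⁻¹ * (permOp (Equiv.swap i j) - 1) * mulOp (coord k) =
      mulOp (coord k) * (mulOp (coord i - coord j)⁻¹ * (permOp (Equiv.swap i j) - 1)) +
      mulOp ((coord i - coord j)⁻¹ * (coord (Equiv.swap i j k) - coord k)) *
        permOp (Equiv.swap i j) := by
  ext f
  simp only [Module.End.mul_apply, LinearMap.sub_apply, LinearMap.add_apply, mulOp_apply,
    permOp_mul_apply, permOp_coord, Module.End.one_apply]
  ring

/-- The exchange term for `j` contributes the quotient of `x_{s_ij k} - x_k` by `x_i - x_j`, which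
is `-1` for `k = i`, `1` for `k = j` and `0` otherwise. -/
theorem dunkl_mul_coord (m : ℂ) (i k : Fin N) :
    dunkl m i * mulOp (coord k) = mulOp (coord k) * dunkl m i + dunklCoordComm m i k := by
  have h : ∀ j ∈ Finset.univ.erase i,
      mulOp (coord i - coord j)⁻¹ * (permOp (Equiv.swap i j) - 1) * mulOp (coord k) =
      mulOp (coord k) * (mulOp (coord i - coord j)⁻¹ * (permOp (Equiv.swap i j) - 1)) +
      mulOp ((coord i - coord j)⁻¹ * (coord (Equiv.swap i j k) - coord k)) *
        permOp (Equiv.swap i j) := fun j _ => exchange_mul_coord i j k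
  unfold dunkl
  rw [add_mul, mul_add, smul_mul_assoc, mul_smul_comm, Finset.sum_mul, Finset.sum_congr rfl h,
    Finset.sum_add_distrib, partialD_mul_mulOp, Finset.mul_sum, smul_add]
  have key : mulOp (partialD i (coord k)) + m • ∑ j ∈ Finset.univ.erase i,
      mulOp ((coord i - coord j)⁻¹ * (coord (Equiv.swap i j k) - coord k)) *
        permOp (Equiv.swap i j) = dunklCoordComm m i k := by
    by_cases hik : i = k
    · subst hik
      have h' : ∀ j ∈ Finset.univ.erase i,
          mulOp ((coord i - coord j)⁻¹ * (coord (Equiv.swap i j i) - coord i)) *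
            permOp (Equiv.swap i j) = -permOp (Equiv.swap i j) := by
        intro j hj
        have hne := coord_sub_ne_zero (N := N) (Finset.ne_of_mem_erase hj).symm
        rw [Equiv.swap_apply_left, ← neg_sub (coord i) (coord j), mul_neg, inv_mul_cancel₀ hne]
        ext f; simp [mulOp_apply]
      rw [dunklCoordComm_self, partialD_coord_self, mulOp_one, Finset.sum_congr rfl h',
        Finset.sum_neg_distrib]
      module
    · rw [dunklCoordComm_of_ne m hik, partialD_coord_of_ne (Ne.symm hik),
        Finset.sum_eq_single k]
      · rw [Equiv.swap_apply_right, inv_mul_cancel₀ (coord_sub_ne_zero hik)]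
        ext f; simp [mulOp_apply]
      · intro j _ hjk
        rw [Equiv.swap_apply_of_ne_of_ne (Ne.symm hik) hjk.symm]
        ext f; simp [mulOp_apply]
      · intro hk; simp [Ne.symm hik] at hk
  rw [← key]; abel

theorem dunkl_apply_invariant (m : ℂ) (i : Fin N) {f : RatFun N}
    (hf : ∀ σ, permOp σ f = f) : dunkl m i f = partialD i f := by
  simp [dunkl, LinearMap.sum_apply, hf]

/-- This is `[[D_i, x_k], D_j] = [[D_j, x_k], D_i]`, equivalent to `[D_i, D_j]` commuting with
`x_k`. For `k = j` the swaps `s_jl` with `l ≠ i` commute with `D_i`, and `s_ij` exchanges `D_i` and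
`D_j`. For `k` outside `{i, j}` the swap `s_ik` commutes with `D_j`, and `s_jk` with `D_i`. -/
theorem dunklCoordComm_comm (m : ℂ) {i j : Fin N} (hij : i ≠ j) (k : Fin N) :
    dunklCoordComm m i k * dunkl m j + dunkl m i * dunklCoordComm m j k =
      dunklCoordComm m j k * dunkl m i + dunkl m j * dunklCoordComm m i k := by
  have main : ∀ {i j : Fin N}, i ≠ j →
      dunklCoordComm m i j * dunkl m j + dunkl m i * dunklCoordComm m j j =
      dunklCoordComm m j j * dunkl m i + dunkl m j * dunklCoordComm m i j := by
    intro i j hij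
    have hsum : ∑ l ∈ Finset.univ.erase j, permOp (Equiv.swap j l) =
        permOp (Equiv.swap i j) +
          ∑ l ∈ (Finset.univ.erase j).erase i, permOp (Equiv.swap j l) := by
      rw [Equiv.swap_comm i j]
      exact (Finset.add_sum_erase _ (fun l => permOp (Equiv.swap j l)) (by simp [hij])).symm
    have hcomm : dunkl m i * ∑ l ∈ (Finset.univ.erase j).erase i, permOp (Equiv.swap j l) =
        (∑ l ∈ (Finset.univ.erase j).erase i, permOp (Equiv.swap j l)) * dunkl m i := by
      rw [Finset.mul_sum, Finset.sum_mul]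
      refine Finset.sum_congr rfl (fun l hl => ?_)
      rw [permOp_mul_dunkl, Equiv.swap_apply_of_ne_of_ne hij (Finset.ne_of_mem_erase hl).symm]
    have h1 := permOp_mul_dunkl m (Equiv.swap i j) i
    have h2 := permOp_mul_dunkl m (Equiv.swap i j) j
    rw [Equiv.swap_apply_left] at h1
    rw [Equiv.swap_apply_right] at h2
    rw [dunklCoordComm_self, dunklCoordComm_of_ne m hij, hsum]
    simp only [mul_sub, sub_mul, smul_add, mul_add, add_mul, smul_mul_assoc, mul_smul_comm,
      mul_one, one_mul, hcomm, h1, h2]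
    abel
  by_cases hkj : k = j
  · subst hkj; exact main hij
  by_cases hki : k = i
  · subst hki
    exact (main hij.symm).symm
  · rw [dunklCoordComm_of_ne m (Ne.symm hki), dunklCoordComm_of_ne m (Ne.symm hkj)]
    simp only [smul_mul_assoc, mul_smul_comm, permOp_mul_dunkl]
    rw [Equiv.swap_apply_of_ne_of_ne hij.symm (Ne.symm hkj),
      Equiv.swap_apply_of_ne_of_ne hij (Ne.symm hki), add_comm]

/-- The commutator commutes with every coordinate and kills 1, hence is zero. -/
theorem dunkl_comm (m : ℂ) (i j : Fin N) : dunkl m i * dunkl m j = dunkl m j * dunkl m i := by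
  by_cases hij : i = j
  · rw [hij]
  rw [← sub_eq_zero]
  refine eq_zero_of_commute_coord (fun k => ?_) ?_
  · have h := dunklCoordComm_comm m hij k
    have e : ∀ a b : Fin N, dunkl m a * dunkl m b * mulOp (coord k) =
        mulOp (coord k) * (dunkl m a * dunkl m b) +
          (dunklCoordComm m a k * dunkl m b + dunkl m a * dunklCoordComm m b k) := by
      intro a b
      rw [mul_assoc, dunkl_mul_coord, mul_add, ← mul_assoc, dunkl_mul_coord]
      noncomm_ring
    rw [sub_mul, mul_sub, e, e, h]
    abel
  · have h1 : ∀ a : Fin N, dunkl m a 1 = 0 := fun a => by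
      rw [dunkl_apply_invariant m a permOp_apply_one, partialD_one]
    simp [h1]

/-! ### The Dunkl Laplacian and the deformed Polychronakos operators -/

/-- The sum of the squares of the Dunkl operators. -/
def dunklLaplacian (N : ℕ) (m : ℂ) : Op N := ∑ i, dunkl m i ^ 2

theorem permOp_mul_dunklLaplacian (m : ℂ) (σ : Equiv.Perm (Fin N)) :
    permOp σ * dunklLaplacian N m = dunklLaplacian N m * permOp σ := by
  unfold dunklLaplacian
  rw [Finset.mul_sum, Finset.sum_mul]
  refine Finset.sum_equiv σ (by simp) (fun j _ => ?_)
  rw [pow_two, pow_two, ← mul_assoc, permOp_mul_dunkl, mul_assoc, permOp_mul_dunkl, mul_assoc]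

theorem dunklLaplacian_mul_dunkl (m : ℂ) (i : Fin N) :
    dunklLaplacian N m * dunkl m i = dunkl m i * dunklLaplacian N m := by
  unfold dunklLaplacian
  rw [Finset.mul_sum, Finset.sum_mul]
  refine Finset.sum_congr rfl (fun j _ => ?_)
  rw [pow_two, mul_assoc, dunkl_comm m j i, ← mul_assoc, dunkl_comm m j i, mul_assoc]

/-- The terms `j ≠ i` give `m (D_i s_ij + s_ij D_i)`, and these cancel against the swaps in `[D_i,
x_i]`. Only `2 D_i` survives. -/
theorem dunklLaplacian_mul_coord (m : ℂ) (i : Fin N) :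
    dunklLaplacian N m * mulOp (coord i) =
      mulOp (coord i) * dunklLaplacian N m + (2 : ℂ) • dunkl m i := by
  have e : ∀ j : Fin N, dunkl m j ^ 2 * mulOp (coord i) = mulOp (coord i) * dunkl m j ^ 2 +
      (dunklCoordComm m j i * dunkl m j + dunkl m j * dunklCoordComm m j i) := by
    intro j
    rw [pow_two, mul_assoc, dunkl_mul_coord, mul_add, ← mul_assoc, dunkl_mul_coord]
    noncomm_ring
  unfold dunklLaplacian
  simp_rw [Finset.sum_mul, e, Finset.sum_add_distrib, Finset.mul_sum]
  congr 1
  rw [← Finset.sum_add_distrib, ← Finset.add_sum_erase _ _ (Finset.mem_univ i),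
    dunklCoordComm_self]
  have h : ∀ j ∈ Finset.univ.erase i,
      dunklCoordComm m j i * dunkl m j + dunkl m j * dunklCoordComm m j i =
        m • (dunkl m i * permOp (Equiv.swap i j) + permOp (Equiv.swap i j) * dunkl m i) := by
    intro j hj
    rw [dunklCoordComm_of_ne m (Finset.ne_of_mem_erase hj), Equiv.swap_comm j i, smul_mul_assoc,
      mul_smul_comm, permOp_mul_dunkl, permOp_mul_dunkl, Equiv.swap_apply_left,
      Equiv.swap_apply_right, smul_add]
  rw [Finset.sum_congr rfl h, ← Finset.smul_sum, Finset.sum_add_distrib, ← Finset.mul_sum,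
    ← Finset.sum_mul, mul_sub, sub_mul, smul_mul_assoc, mul_smul_comm, two_smul, smul_add,
    mul_one, one_mul]
  abel

/-- The operator `(x_i - D_i) D_i`, the image of `π_i = x_i D_i` under the flow of
`T ↦ [T, ∑ D_j²] / 2`. -/
def harmonicPolychronakos (m : ℂ) (i : Fin N) : Op N := polychronakos m i - dunkl m i ^ 2

theorem polychronakos_lie (m : ℂ) (i : Fin N) :
    ⁅polychronakos m i, dunklLaplacian N m⁆ = -((2 : ℂ) • dunkl m i ^ 2) := by
  rw [Ring.lie_def, polychronakos, ← mul_assoc (dunklLaplacian N m), dunklLaplacian_mul_coord,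
    mul_assoc, ← dunklLaplacian_mul_dunkl, add_mul, smul_mul_assoc, pow_two]
  noncomm_ring

theorem dunkl_sq_lie (m : ℂ) (i : Fin N) : ⁅dunkl m i ^ 2, dunklLaplacian N m⁆ = 0 := by
  rw [Ring.lie_def, pow_two, ← mul_assoc (dunklLaplacian N m), dunklLaplacian_mul_dunkl,
    mul_assoc, mul_assoc, dunklLaplacian_mul_dunkl, sub_self]

theorem permOp_mul_harmonicPolychronakos (m : ℂ) (σ : Equiv.Perm (Fin N)) (i : Fin N) :
    permOp σ * harmonicPolychronakos m i = harmonicPolychronakos m (σ i) * permOp σ := by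
  rw [harmonicPolychronakos, harmonicPolychronakos, polychronakos, polychronakos, mul_sub,
    ← mul_assoc, permOp_mul_mulOp, permOp_coord, mul_assoc, permOp_mul_dunkl, pow_two,
    ← mul_assoc (permOp σ), permOp_mul_dunkl, mul_assoc (dunkl m (σ i)), permOp_mul_dunkl]
  simp only [sub_mul, mul_assoc, pow_two]

theorem permOp_mul_polychronakos (m : ℂ) (σ : Equiv.Perm (Fin N)) (i : Fin N) :
    permOp σ * polychronakos m i = polychronakos m (σ i) * permOp σ := by
  rw [polychronakos, polychronakos, ← mul_assoc, permOp_mul_mulOp, permOp_coord, mul_assoc,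
    permOp_mul_dunkl, mul_assoc]

/-- Factor `h_k = (x_k - D_k) D_k`. The first factors commute among themselves, as do the second
ones, so the bracket comes only from moving `D_i` past `x_j - D_j` and `D_j` past `x_i - D_i`, each
at the cost of `m s_ij`. -/
theorem harmonicPolychronakos_comm (m : ℂ) (i j : Fin N) :
    harmonicPolychronakos m i * harmonicPolychronakos m j -
      harmonicPolychronakos m j * harmonicPolychronakos m i =
    m • (permOp (Equiv.swap i j) * (harmonicPolychronakos m j - harmonicPolychronakos m i)) := by
  by_cases hij : i = j
  · subst hij; simp
  have hD := dunkl_comm m i j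
  have hx := mulOp_comm (N := N) (coord i) (coord j)
  have h1 := dunkl_mul_coord m i j
  have h2 := dunkl_mul_coord m j i
  rw [dunklCoordComm_of_ne m hij] at h1
  rw [dunklCoordComm_of_ne m (Ne.symm hij), Equiv.swap_comm j i] at h2
  set s := permOp (Equiv.swap i j)
  -- The cross terms `[D_i, x_j]` and `[D_j, x_i]` both equal `m s_ij` and cancel.
  have hxx : (mulOp (coord i) - dunkl m i) * (mulOp (coord j) - dunkl m j) =
      (mulOp (coord j) - dunkl m j) * (mulOp (coord i) - dunkl m i) := by
    simp only [mul_sub, sub_mul, h1, h2, hx, hD]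
    abel
  have h1' : dunkl m i * (mulOp (coord j) - dunkl m j) =
      (mulOp (coord j) - dunkl m j) * dunkl m i + m • s := by
    simp only [mul_sub, sub_mul, h1, hD]
    abel
  have h2' : dunkl m j * (mulOp (coord i) - dunkl m i) =
      (mulOp (coord i) - dunkl m i) * dunkl m j + m • s := by
    simp only [mul_sub, sub_mul, h2, hD]
    abel
  have hh : ∀ k : Fin N,
      harmonicPolychronakos m k = (mulOp (coord k) - dunkl m k) * dunkl m k := by
    intro k; rw [harmonicPolychronakos, polychronakos, sub_mul, pow_two]
  have hs1 : s * harmonicPolychronakos m j = harmonicPolychronakos m i * s := by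
    rw [permOp_mul_harmonicPolychronakos, Equiv.swap_apply_right]
  have hs2 : s * harmonicPolychronakos m i = harmonicPolychronakos m j * s := by
    rw [permOp_mul_harmonicPolychronakos, Equiv.swap_apply_left]
  have hsD1 : s * dunkl m j = dunkl m i * s := by
    rw [permOp_mul_dunkl, Equiv.swap_apply_right]
  have hsD2 : s * dunkl m i = dunkl m j * s := by
    rw [permOp_mul_dunkl, Equiv.swap_apply_left]
  rw [mul_sub, hs1, hs2]
  simp only [hh]
  set a := mulOp (coord i) - dunkl m i
  set b := mulOp (coord j) - dunkl m j
  calc a * dunkl m i * (b * dunkl m j) - b * dunkl m j * (a * dunkl m i)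
      = a * (dunkl m i * b) * dunkl m j - b * (dunkl m j * a) * dunkl m i := by noncomm_ring
    _ = (a * b) * (dunkl m i * dunkl m j) - (b * a) * (dunkl m j * dunkl m i)
        + m • (a * (s * dunkl m j) - b * (s * dunkl m i)) := by
      rw [h1', h2']
      simp only [mul_add, add_mul, mul_smul_comm, smul_mul_assoc, smul_sub, mul_assoc]
      abel
    _ = _ := by
      rw [hxx, hD, sub_self, zero_add, hsD1, hsD2, ← mul_assoc, ← mul_assoc]

/-- On an invariant `f` the inner `D_i` is `∂_i`, and `s_ij ∂_i f = ∂_j f`, so the outer one yields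
difference quotients symmetric in `i, j`. Summing over all ordered pairs produces the factor 2 in
`L`. -/
theorem dunklLaplacian_apply_invariant (m : ℂ) {f : RatFun N} (hf : ∀ σ, permOp σ f = f) :
    dunklLaplacian N m f = rationalCM N m f := by
  have hp : ∀ (σ : Equiv.Perm (Fin N)) (i : Fin N),
      permOp σ (partialD i f) = partialD (σ i) f := by
    intro σ i
    have := LinearMap.congr_fun (permOp_mul_partialD σ i) f
    simpa [hf] using this
  set g : Fin N → Fin N → RatFun N :=
    fun i j => (coord i - coord j)⁻¹ * (partialD i f - partialD j f) with hg
  have hsymm : ∀ i j, g i j = g j i := by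
    intro i j
    have hinv : (coord i - coord j : RatFun N)⁻¹ = -(coord j - coord i)⁻¹ := by
      rw [neg_inv, neg_sub]
    simp only [hg, hinv]
    ring
  have hdiag : ∀ i, g i i = 0 := by intro i; simp [hg]
  have h1 : ∀ i : Fin N, (dunkl m i ^ 2) f = (partialD i ^ 2) f - m • ∑ j, g i j := by
    intro i
    rw [pow_two, Module.End.mul_apply, dunkl_apply_invariant m i hf, pow_two,
      ← Finset.add_sum_erase _ _ (Finset.mem_univ i), hdiag, zero_add]
    simp only [dunkl, LinearMap.add_apply, LinearMap.smul_apply, LinearMap.sum_apply,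
      Module.End.mul_apply, mulOp_apply, LinearMap.sub_apply, Module.End.one_apply, hp,
      Equiv.swap_apply_left]
    rw [sub_eq_add_neg, ← smul_neg, ← Finset.sum_neg_distrib]
    congr 2
    refine Finset.sum_congr rfl (fun j _ => ?_)
    simp only [hg]; ring
  have h2 : ∑ i, ∑ j, g i j = (2 : ℂ) • ∑ i, ∑ j ∈ Finset.Ioi i, g i j := by
    have split : ∀ i, ∑ j, g i j = ∑ j ∈ Finset.Ioi i, g i j + ∑ j ∈ Finset.Iio i, g i j := by
      intro i
      rw [← Finset.add_sum_erase _ _ (Finset.mem_univ i), hdiag, zero_add, ← Finset.sum_union]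
      · refine Finset.sum_congr ?_ (fun _ _ => rfl)
        ext j; simp [lt_or_lt_iff_ne, eq_comm]
      · rw [Finset.disjoint_left]; intro j h h'
        simp only [Finset.mem_Ioi, Finset.mem_Iio] at h h'
        exact lt_asymm h h'
    have hflip : ∑ i, ∑ j ∈ Finset.Iio i, g i j = ∑ i, ∑ j ∈ Finset.Ioi i, g i j := by
      rw [Finset.sum_comm' (t' := Finset.univ) (s' := fun j => Finset.Ioi j)
        (by intro x y; simp)]
      exact Finset.sum_congr rfl (fun i _ => Finset.sum_congr rfl (fun j _ => hsymm _ _))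
    simp_rw [split]
    rw [Finset.sum_add_distrib, hflip, two_smul]
  simp only [dunklLaplacian, rationalCM, LinearMap.sum_apply, LinearMap.sub_apply, h1,
    Finset.sum_sub_distrib, ← Finset.smul_sum, h2, LinearMap.smul_apply, Module.End.mul_apply,
    mulOp_apply]
  rw [smul_smul, mul_comm m 2]

/-! ### Differential operators are determined by symmetric polynomials -/

/-- Operators of differential order less than `n` in the sense of Grothendieck: `n` successive
commutators with multiplications annihilate them. -/
def HasOrderLT : ℕ → Op N → Prop
  | 0, A => A = 0
  | n + 1, A => ∀ f : RatFun N, HasOrderLT n (A * mulOp f - mulOp f * A)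

theorem HasOrderLT.zero (n : ℕ) : HasOrderLT n (0 : Op N) := by
  induction n with
  | zero => rfl
  | succ n ih => intro f; simpa using ih

theorem HasOrderLT.add {n : ℕ} {A B : Op N} (hA : HasOrderLT n A) (hB : HasOrderLT n B) :
    HasOrderLT n (A + B) := by
  induction n generalizing A B with
  | zero => change A + B = 0; rw [show A = 0 from hA, show B = 0 from hB, add_zero]
  | succ n ih =>
    intro f
    have := ih (hA f) (hB f)
    rwa [show (A + B) * mulOp f - mulOp f * (A + B) =
      (A * mulOp f - mulOp f * A) + (B * mulOp f - mulOp f * B) by noncomm_ring]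

theorem HasOrderLT.succ {n : ℕ} {A : Op N} (hA : HasOrderLT n A) : HasOrderLT (n + 1) A := by
  induction n generalizing A with
  | zero => rw [show A = 0 from hA]; exact HasOrderLT.zero _
  | succ n ih => exact fun f => ih (hA f)

theorem HasOrderLT.mono {n k : ℕ} (h : n ≤ k) {A : Op N} (hA : HasOrderLT n A) :
    HasOrderLT k A := by
  induction h with
  | refl => exact hA
  | step _ ih => exact ih.succ

theorem HasOrderLT.mul {a b : ℕ} {A B : Op N} (hA : HasOrderLT a A) (hB : HasOrderLT b B) :
    HasOrderLT (a + b) (A * B) := by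
  induction hn : a + b generalizing a b A B with
  | zero =>
    obtain ⟨rfl, rfl⟩ : a = 0 ∧ b = 0 := by omega
    rw [show A = 0 from hA, zero_mul]; exact HasOrderLT.zero _
  | succ n ih =>
    rcases a with _ | a
    · rw [show A = 0 from hA, zero_mul]; exact HasOrderLT.zero _
    rcases b with _ | b
    · rw [show B = 0 from hB, mul_zero]; exact HasOrderLT.zero _
    intro f
    rw [show A * B * mulOp f - mulOp f * (A * B) =
      A * (B * mulOp f - mulOp f * B) + (A * mulOp f - mulOp f * A) * B by
        simp only [mul_sub, sub_mul, mul_assoc]; abel]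
    exact (ih hA (hB f) (by omega)).add (ih (hA f) hB (by omega))

theorem hasOrderLT_mulOp (f : RatFun N) : HasOrderLT 1 (mulOp f) := by
  intro g
  change _ = _
  rw [mulOp_comm, sub_self]

theorem exists_hasOrderLT {T : Op N} (hT : T ∈ diffOps N) : ∃ n, HasOrderLT n T := by
  induction hT using Algebra.adjoin_induction with
  | mem A hA =>
    rcases hA with (⟨i, rfl⟩ | ⟨i, j, _, rfl⟩) | ⟨i, rfl⟩
    · exact ⟨1, hasOrderLT_mulOp _⟩
    · exact ⟨1, hasOrderLT_mulOp _⟩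
    · refine ⟨2, fun f => ?_⟩
      rw [partialD_mul_mulOp, add_sub_cancel_left]
      exact hasOrderLT_mulOp _
  | algebraMap r =>
    refine ⟨1, fun f => ?_⟩
    change _ = _
    rw [Algebra.commutes, sub_self]
  | add A B _ _ hA hB =>
    obtain ⟨a, ha⟩ := hA
    obtain ⟨b, hb⟩ := hB
    exact ⟨a + b, (ha.mono (by omega)).add (hb.mono (by omega))⟩
  | mul A B _ _ hA hB =>
    obtain ⟨a, ha⟩ := hA
    obtain ⟨b, hb⟩ := hB
    exact ⟨a + b, ha.mul hb⟩

/-- Applying `D` to the power sums of degrees `1, …, N` gives a Vandermonde system for the `D x_j`,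
whose nodes `x_j` are distinct elements of the field. -/
theorem derivation_eq_zero_of_symmetric (D : Derivation ℂ (RatFun N) (RatFun N))
    (hD : ∀ p : Poly N, p.IsSymmetric → D (algebraMap _ _ p) = 0) (j : Fin N) :
    D (coord j) = 0 := by
  have hinj : Function.Injective (coord : Fin N → RatFun N) := fun i j h =>
    X_injective (IsFractionRing.injective (Poly N) (RatFun N) h)
  have hv : (fun j => D (coord j)) = 0 := by
    refine Matrix.eq_zero_of_forall_pow_sum_mul_pow_eq_zero hinj (fun i => ?_)
    have h := hD (psum (Fin N) ℂ (i + 1)) (psum_isSymmetric _ _ _)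
    have e : algebraMap (Poly N) (RatFun N) (psum (Fin N) ℂ (i + 1)) =
        ∑ j, coord j ^ ((i : ℕ) + 1) := by
      simp [psum, coord]
    rw [e, map_sum] at h
    simp only [Derivation.leibniz_pow, Nat.add_sub_cancel, smul_eq_mul, ← Finset.smul_sum] at h
    have h' := (smul_eq_zero.mp h).resolve_left (Nat.succ_ne_zero _)
    rw [← h']
    exact Finset.sum_congr rfl fun _ _ => mul_comm _ _
  exact congrFun hv j

theorem eq_mulOp_of_commute_mulOp {U : Op N} (hU : ∀ g, U * mulOp g - mulOp g * U = 0) :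
    U = mulOp (U 1) := by
  ext g
  have h := LinearMap.congr_fun (sub_eq_zero.mp (hU g)) 1
  simpa [mulOp_apply, mul_comm] using h

/-- By induction on the order, each `[T, f]` is a multiplication operator, so `T - T(1)` is a
derivation. It vanishes on symmetric polynomials, hence on the coordinates, and `T` is itself a
multiplication. -/
theorem commute_mulOp_of_commute_symmetric {n : ℕ} {T : Op N} (hT : HasOrderLT n T)
    (hs : ∀ p : Poly N, p.IsSymmetric →
      T * mulOp (algebraMap _ _ p) = mulOp (algebraMap _ _ p) * T) (f : RatFun N) :
    T * mulOp f - mulOp f * T = 0 := by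
  induction n generalizing T f with
  | zero => rw [show T = 0 from hT]; simp
  | succ n ih =>
    have hU : ∀ f g, T (f * g) = f * T g + (T f - f * T 1) * g := by
      intro f g
      have h := eq_mulOp_of_commute_mulOp (U := T * mulOp f - mulOp f * T) (fun g => by
        refine ih (hT f) (fun p hp => ?_) g
        rw [sub_mul, mul_sub, mul_assoc, mulOp_comm f, ← mul_assoc, hs p hp, mul_assoc,
          mul_assoc (mulOp f), hs p hp, ← mul_assoc (mulOp f), mulOp_comm f, mul_assoc])
      have h' := LinearMap.congr_fun h g
      simp only [LinearMap.sub_apply, Module.End.mul_apply, mulOp_apply, mul_one] at h'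
      linear_combination h'
    let D : Derivation ℂ (RatFun N) (RatFun N) :=
      Derivation.mk' (T - mulOp (T 1)) (fun f g => by
        simp only [LinearMap.sub_apply, mulOp_apply, smul_eq_mul, hU f g]
        ring)
    have hD : ∀ f, D f = T f - f * T 1 := fun f => by
      change T f - T 1 * f = _
      rw [mul_comm]
    have hc : ∀ j, D (coord j) = 0 := by
      refine derivation_eq_zero_of_symmetric D (fun p hp => ?_)
      have h := LinearMap.congr_fun (hs p hp) 1
      simp only [Module.End.mul_apply, mulOp_apply, mul_one] at h
      rw [hD, h, sub_self]
    have h0 : T - mulOp (T 1) = 0 := by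
      refine eq_zero_of_commute_coord (fun k => ?_) (by simp [mulOp_apply])
      rw [sub_mul, mul_sub, mulOp_comm]
      congr 1
      ext g
      have h := hc k
      rw [hD] at h
      simp only [Module.End.mul_apply, mulOp_apply]
      rw [hU, h, zero_mul, add_zero]
    rw [sub_eq_zero.mp h0, mulOp_comm, sub_self]

/-- The commutator of `T` with a symmetric polynomial has lower order and still kills symmetric
polynomials, so it is zero by induction. Then `T` is multiplication by `T(1) = 0`. -/
theorem HasOrderLT.eq_zero_of_symmetric {n : ℕ} {T : Op N} (hT : HasOrderLT n T)
    (hs : ∀ p : Poly N, p.IsSymmetric → T (algebraMap _ _ p) = 0) : T = 0 := by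
  induction n generalizing T with
  | zero => exact hT
  | succ n ih =>
    have hc := commute_mulOp_of_commute_symmetric hT (fun p hp => by
      rw [← sub_eq_zero]
      refine ih (hT _) (fun q hq => ?_)
      simp only [LinearMap.sub_apply, Module.End.mul_apply, mulOp_apply, hs q hq, ← map_mul]
      rw [hs _ (hp.mul hq), mul_zero, sub_zero])
    rw [eq_mulOp_of_commute_mulOp hc]
    have := hs 1 IsSymmetric.one
    rw [map_one] at this
    rw [this]
    ext g; simp [mulOp_apply]

/-- A differential operator is determined by its action on symmetric polynomials. -/
theorem diffOps_ext {S T : Op N} (hS : S ∈ diffOps N) (hT : T ∈ diffOps N)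
    (h : ∀ p : Poly N, p.IsSymmetric → S (algebraMap _ _ p) = T (algebraMap _ _ p)) : S = T := by
  rw [← sub_eq_zero]
  obtain ⟨n, hn⟩ := exists_hasOrderLT (sub_mem hS hT)
  exact hn.eq_zero_of_symmetric (fun p hp => by simp [h p hp])

/-! ### Words, their reversals and the spherical algebra -/

theorem lift_word {ι A : Type*} [Ring A] [Algebra ℂ A] (h : ι → A) (l : List ι) :
    FreeAlgebra.lift ℂ h (l.map (FreeAlgebra.ι ℂ)).prod = (l.map h).prod := by
  rw [map_list_prod, List.map_map]
  congr 2
  ext i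
  simp

/-- Evaluation of a non-commutative polynomial with the order of all products reversed. -/
def reverseLift {ι A : Type*} [Ring A] [Algebra ℂ A] (h : ι → A) (P : FreeAlgebra ℂ ι) : A :=
  (FreeAlgebra.lift ℂ (fun i => MulOpposite.op (h i)) P).unop

theorem reverseLift_word {ι A : Type*} [Ring A] [Algebra ℂ A] (h : ι → A) (l : List ι) :
    reverseLift h (l.map (FreeAlgebra.ι ℂ)).prod = (l.reverse.map h).prod := by
  rw [reverseLift, lift_word, MulOpposite.unop_list_prod, List.map_map, List.map_reverse]
  rfl

section Spherical

variable {ι A : Type*} [Ring A] {m : ℂ} {s : Equiv.Perm ι → A} {h : ι → A} {e : A}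

theorem perm_mul_word (hs : ∀ σ i, s σ * h i = h (σ i) * s σ) (σ : Equiv.Perm ι) (l : List ι) :
    s σ * (l.map h).prod = ((l.map σ).map h).prod * s σ := by
  induction l with
  | nil => simp
  | cons i l ih =>
    simp only [List.map_cons, List.prod_cons]
    rw [← mul_assoc, hs, mul_assoc, ih, mul_assoc]

variable [Algebra ℂ A]

theorem perm_mul_lift (hs : ∀ σ i, s σ * h i = h (σ i) * s σ) (σ : Equiv.Perm ι)
    (P : FreeAlgebra ℂ ι) : s σ * FreeAlgebra.lift ℂ h P =
      FreeAlgebra.lift ℂ h (FreeAlgebra.lift ℂ (fun i => FreeAlgebra.ι ℂ (σ i)) P) * s σ := by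
  induction P using FreeAlgebra.induction with
  | grade0 r => simp [Algebra.commutes]
  | grade1 i => simp [hs]
  | mul P Q hP hQ => simp only [map_mul]; rw [← mul_assoc, hP, mul_assoc, hQ, mul_assoc]
  | add P Q hP hQ => simp only [map_add, mul_add, add_mul, hP, hQ]

theorem perm_mul_reverseLift (hs : ∀ σ i, s σ * h i = h (σ i) * s σ) (σ : Equiv.Perm ι)
    (P : FreeAlgebra ℂ ι) : s σ * reverseLift h P =
      reverseLift h (FreeAlgebra.lift ℂ (fun i => FreeAlgebra.ι ℂ (σ i)) P) * s σ := by
  unfold reverseLift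
  induction P using FreeAlgebra.induction with
  | grade0 r => simp [Algebra.commutes]
  | grade1 i => simp [hs]
  | mul P Q hP hQ =>
    simp only [map_mul, MulOpposite.unop_mul]; rw [← mul_assoc, hQ, mul_assoc, hP, mul_assoc]
  | add P Q hP hQ => simp only [map_add, MulOpposite.unop_add, mul_add, add_mul, hP, hQ]

variable [DecidableEq ι]

/-- The swap created by the commutator is moved left through `u`, permuting its letters, and is
absorbed by `e`. What remains is one letter shorter. -/
theorem spherical_word_swap_left (hs : ∀ σ i, s σ * h i = h (σ i) * s σ)
    (hc : ∀ i j, h i * h j - h j * h i = m • (s (Equiv.swap i j) * (h j - h i)))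
    (he : ∀ σ, e * s σ = e) (u v : List ι) (i j : ι) :
    e * ((u ++ i :: j :: v).map h).prod * e - e * ((u ++ j :: i :: v).map h).prod * e =
      m • (e * ((u.map (Equiv.swap i j) ++ j :: v).map h).prod * e -
        e * ((u.map (Equiv.swap i j) ++ i :: v).map h).prod * e) := by
  simp only [List.map_append, List.prod_append, List.map_cons, List.prod_cons]
  have hu := perm_mul_word hs (Equiv.swap i j) (u.map (Equiv.swap i j))
  have huu : (u.map (Equiv.swap i j)).map (Equiv.swap i j) = u := by
    rw [List.map_map]; simp [Function.comp_def]
  rw [huu] at hu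
  set U := (u.map h).prod
  set V := (v.map h).prod
  set U' := ((u.map (Equiv.swap i j)).map h).prod
  calc _ = e * U * (h i * h j - h j * h i) * V * e := by noncomm_ring
    _ = m • (e * (U * s (Equiv.swap i j)) * (h j - h i) * V * e) := by
      rw [hc, mul_smul_comm, smul_mul_assoc, smul_mul_assoc]
      simp only [mul_assoc]
    _ = m • ((e * s (Equiv.swap i j)) * U' * (h j - h i) * V * e) := by
      rw [← hu]; simp only [mul_assoc]
    _ = _ := by rw [he]; congr 1; noncomm_ring

/-- Mirror image: the swap leaves on the right, permuting `v`. Reversing a word exchanges the two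
forms. -/
theorem spherical_word_swap_right (hs : ∀ σ i, s σ * h i = h (σ i) * s σ)
    (hc : ∀ i j, h i * h j - h j * h i = m • (s (Equiv.swap i j) * (h j - h i)))
    (he : ∀ σ, s σ * e = e) (u v : List ι) (i j : ι) :
    e * ((u ++ i :: j :: v).map h).prod * e - e * ((u ++ j :: i :: v).map h).prod * e =
      m • (e * ((u ++ i :: v.map (Equiv.swap i j)).map h).prod * e -
        e * ((u ++ j :: v.map (Equiv.swap i j)).map h).prod * e) := by
  simp only [List.map_append, List.prod_append, List.map_cons, List.prod_cons]
  have hv := perm_mul_word hs (Equiv.swap i j) v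
  set U := (u.map h).prod
  set V := (v.map h).prod
  set V' := ((v.map (Equiv.swap i j)).map h).prod
  have hij : s (Equiv.swap i j) * (h j - h i) = (h i - h j) * s (Equiv.swap i j) := by
    rw [mul_sub, hs, hs, Equiv.swap_apply_left, Equiv.swap_apply_right, sub_mul]
  calc _ = e * U * (h i * h j - h j * h i) * V * e := by noncomm_ring
    _ = m • (e * U * (h i - h j) * (s (Equiv.swap i j) * V) * e) := by
      rw [hc, hij, mul_smul_comm, smul_mul_assoc, smul_mul_assoc]
      simp only [mul_assoc]
    _ = m • (e * U * (h i - h j) * V' * (s (Equiv.swap i j) * e)) := by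
      rw [hv]; simp only [mul_assoc]
    _ = _ := by rw [he]; congr 1; noncomm_ring

/-- In the spherical algebra a word agrees with its reversal. -/
theorem spherical_word_reverse (hs : ∀ σ i, s σ * h i = h (σ i) * s σ)
    (hc : ∀ i j, h i * h j - h j * h i = m • (s (Equiv.swap i j) * (h j - h i)))
    (he : ∀ σ, e * s σ = e) (he' : ∀ σ, s σ * e = e) (l : List ι) :
    e * (l.map h).prod * e = e * (l.reverse.map h).prod * e := by
  induction hn : l.length using Nat.strong_induction_on generalizing l with
  | _ n ih =>
  set φ : List ι → A := fun l => e * (l.map h).prod * e with hφ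
  -- The defect `φ l - φ l.reverse` does not change when neighbouring letters are exchanged: the
  -- corrections for `l` and for its reversal are reversals of each other and shorter, so they agree
  -- by induction.
  have hswap : ∀ (u v : List ι) (i j : ι), (u ++ i :: j :: v).length = n →
      φ (u ++ i :: j :: v) - φ (u ++ i :: j :: v).reverse =
      φ (u ++ j :: i :: v) - φ (u ++ j :: i :: v).reverse := by
    intro u v i j hlen
    have h1 := spherical_word_swap_left hs hc he u v i j
    have h2 := spherical_word_swap_right hs hc he' v.reverse u.reverse j i
    rw [Equiv.swap_comm j i] at h2
    have i1 := ih (n - 1) (by simp at hlen; omega) (u.map (Equiv.swap i j) ++ j :: v)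
      (by simp at hlen ⊢; omega)
    have i2 := ih (n - 1) (by simp at hlen; omega) (u.map (Equiv.swap i j) ++ i :: v)
      (by simp at hlen ⊢; omega)
    rw [i1, i2] at h1
    have r : ∀ k, (u.map (Equiv.swap i j) ++ k :: v).reverse =
        v.reverse ++ k :: u.reverse.map (Equiv.swap i j) := by intro k; simp
    have r' : ∀ k l, (u ++ k :: l :: v).reverse = v.reverse ++ l :: k :: u.reverse := by
      intro k l; simp
    rw [r, r, ← h2] at h1
    simp only [hφ, r']
    exact sub_eq_sub_iff_sub_eq_sub.mp h1
  have hperm : ∀ {l l' : List ι}, l.Perm l' → ∀ u : List ι, (u ++ l).length = n →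
      φ (u ++ l) - φ (u ++ l).reverse = φ (u ++ l') - φ (u ++ l').reverse := by
    intro l l' hp
    induction hp with
    | nil => intro u _; rfl
    | cons a _ ih' =>
      intro u hu
      have := ih' (u ++ [a]) (by simpa [add_assoc, add_comm] using hu)
      simpa using this
    | swap a b l => intro u hu; exact hswap u l b a hu
    | trans h₁ h₂ ih₁ ih₂ =>
      intro u hu
      rw [ih₁ u hu, ih₂ u (by rw [← hu]; simp [h₁.length_eq])]
  have hrev := hperm (List.reverse_perm l).symm [] (by simpa using hn)
  simp only [List.nil_append, List.reverse_reverse] at hrev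
  -- The reversal is a permutation of `l`, so the defect equals its own negative.
  have h2 : (2 : ℂ) • (φ l - φ l.reverse) = 0 := by
    rw [two_smul]
    nth_rewrite 2 [hrev]
    abel
  exact sub_eq_zero.mp ((smul_eq_zero.mp h2).resolve_left two_ne_zero)

theorem freeAlgebra_mem_span_words {ι : Type*} (P : FreeAlgebra ℂ ι) :
    P ∈ Submodule.span ℂ (Set.range fun l : List ι => (l.map (FreeAlgebra.ι ℂ)).prod) := by
  induction P using FreeAlgebra.induction with
  | grade0 r =>
    rw [Algebra.algebraMap_eq_smul_one]
    exact Submodule.smul_mem _ _ (Submodule.subset_span ⟨[], by simp⟩)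
  | grade1 i => exact Submodule.subset_span ⟨[i], by simp⟩
  | mul P Q hP hQ =>
    have h := Submodule.mul_mem_mul hP hQ
    rw [Submodule.span_mul_span] at h
    refine Submodule.span_mono ?_ h
    rintro _ ⟨_, ⟨l, rfl⟩, _, ⟨l', rfl⟩, rfl⟩
    exact ⟨l ++ l', by simp⟩
  | add P Q hP hQ => exact add_mem hP hQ

theorem spherical_lift_eq_reverseLift (hs : ∀ σ i, s σ * h i = h (σ i) * s σ)
    (hc : ∀ i j, h i * h j - h j * h i = m • (s (Equiv.swap i j) * (h j - h i)))
    (he : ∀ σ, e * s σ = e) (he' : ∀ σ, s σ * e = e) (P : FreeAlgebra ℂ ι) :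
    e * FreeAlgebra.lift ℂ h P * e = e * reverseLift h P * e := by
  induction freeAlgebra_mem_span_words P using Submodule.span_induction with
  | mem P hP =>
    obtain ⟨l, rfl⟩ := hP
    simp only [lift_word, reverseLift_word]
    exact spherical_word_reverse hs hc he he' l
  | zero => simp [reverseLift]
  | add P Q _ _ hP hQ =>
    simp only [reverseLift, map_add, MulOpposite.unop_add, mul_add, add_mul] at *
    rw [hP, hQ]
  | smul r P _ hP =>
    simp only [reverseLift, map_smul, MulOpposite.unop_smul, mul_smul_comm, smul_mul_assoc] at *
    rw [hP]

/-- Invariant non-commutative polynomials in generators satisfying the relations of the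
degenerate affine Hecke algebra commute on invariants. -/
theorem spherical_commute (hs : ∀ σ i, s σ * h i = h (σ i) * s σ)
    (hc : ∀ i j, h i * h j - h j * h i = m • (s (Equiv.swap i j) * (h j - h i)))
    (he : ∀ σ, e * s σ = e) (he' : ∀ σ, s σ * e = e)
    (hcomm : ∀ a, (∀ σ, s σ * a = a * s σ) → e * a = a * e)
    {c : ℂ} (hc0 : c ≠ 0) (hee : e * e = c • e) {P Q : FreeAlgebra ℂ ι}
    (hP : ∀ σ : Equiv.Perm ι, FreeAlgebra.lift ℂ (fun i => FreeAlgebra.ι ℂ (σ i)) P = P)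
    (hQ : ∀ σ : Equiv.Perm ι, FreeAlgebra.lift ℂ (fun i => FreeAlgebra.ι ℂ (σ i)) Q = Q) :
    FreeAlgebra.lift ℂ h P * FreeAlgebra.lift ℂ h Q * e =
      FreeAlgebra.lift ℂ h Q * FreeAlgebra.lift ℂ h P * e := by
  have cL : ∀ R : FreeAlgebra ℂ ι,
      (∀ σ : Equiv.Perm ι, FreeAlgebra.lift ℂ (fun i => FreeAlgebra.ι ℂ (σ i)) R = R) →
      e * FreeAlgebra.lift ℂ h R = FreeAlgebra.lift ℂ h R * e := fun R hR =>
    hcomm _ (fun σ => by rw [perm_mul_lift hs, hR])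
  have cR : ∀ R : FreeAlgebra ℂ ι,
      (∀ σ : Equiv.Perm ι, FreeAlgebra.lift ℂ (fun i => FreeAlgebra.ι ℂ (σ i)) R = R) →
      e * reverseLift h R = reverseLift h R * e := fun R hR =>
    hcomm _ (fun σ => by rw [perm_mul_reverseLift hs, hR])
  -- An invariant `R` commutes with `e`, so one of the two symmetrizers turns into the scalar `c`
  -- and can be cancelled.
  have key : ∀ R : FreeAlgebra ℂ ι,
      (∀ σ : Equiv.Perm ι, FreeAlgebra.lift ℂ (fun i => FreeAlgebra.ι ℂ (σ i)) R = R) →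
      FreeAlgebra.lift ℂ h R * e = reverseLift h R * e := by
    intro R hR
    have h1 := spherical_lift_eq_reverseLift hs hc he he' R
    rw [cL R hR, cR R hR, mul_assoc, mul_assoc, hee, mul_smul_comm, mul_smul_comm] at h1
    exact smul_right_injective A hc0 h1
  have hPQ : ∀ σ : Equiv.Perm ι,
      FreeAlgebra.lift ℂ (fun i => FreeAlgebra.ι ℂ (σ i)) (P * Q) = P * Q := fun σ => by
    rw [map_mul, hP, hQ]
  -- Writing `'` for reversal, on `e` one has `PQ = (PQ)' = Q'P' = Q'P = QP`, the last step by
  -- passing `P` through `e`.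
  have h1 := key (P * Q) hPQ
  have h2 : reverseLift h (P * Q) = reverseLift h Q * reverseLift h P := by simp [reverseLift]
  rw [map_mul] at h1
  rw [h1, h2, mul_assoc, ← key P hP, ← cL P hP, ← mul_assoc, ← key Q hQ, mul_assoc, cL P hP,
    mul_assoc]

end Spherical

/-! ### The truncated exponential of a commutator -/

section LieSeries

variable {ι A : Type*} [Ring A] [Algebra ℂ A]

/-- The linear map `T ↦ [T, H]`. -/
def rightLie (H : A) : A →ₗ[ℂ] A := LinearMap.mulRight ℂ H - LinearMap.mulLeft ℂ H

theorem rightLie_apply (H T : A) : rightLie H T = ⁅T, H⁆ := rfl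

/-- The truncated exponential series of `T ↦ [T, H] / 2`. -/
def lieSeries (H : A) (d : ℕ) : A →ₗ[ℂ] A :=
  ∑ k ∈ Finset.range (d + 1), ((2 : ℂ) ^ k * (k.factorial : ℂ))⁻¹ • rightLie H ^ k

theorem lieSeries_apply (H : A) (d : ℕ) (T : A) : lieSeries H d T =
    ∑ k ∈ Finset.range (d + 1), ((2 : ℂ) ^ k * (k.factorial : ℂ))⁻¹ • (rightLie H ^ k) T := by
  simp [lieSeries, LinearMap.sum_apply]

theorem rightLie_mul (H S T : A) : rightLie H (S * T) = S * rightLie H T + rightLie H S * T := by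
  simp only [rightLie_apply, Ring.lie_def]
  noncomm_ring

theorem rightLie_pow_succ_mul {H S : A} (hS : rightLie H (rightLie H S) = 0) (T : A) (k : ℕ) :
    (rightLie H ^ (k + 1)) (S * T) = S * (rightLie H ^ (k + 1)) T +
      ((k : ℂ) + 1) • (rightLie H S * (rightLie H ^ k) T) := by
  induction k with
  | zero => simp [rightLie_mul]
  | succ k ih =>
    rw [pow_succ', Module.End.mul_apply, ih, map_add, map_smul, rightLie_mul, rightLie_mul, hS,
      zero_mul, add_zero, ← Module.End.mul_apply, ← pow_succ', ← Module.End.mul_apply,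
      ← pow_succ']
    push_cast
    module

/-- Multiplicativity of the exponential, in truncated form. As the second bracket of `S` vanishes,
the Leibniz rule has two terms; the second uses up one commutator, so its series for `T` stops one
step earlier. -/
theorem lieSeries_succ_mul {H S : A} (hS : rightLie H (rightLie H S) = 0) (T : A) (d : ℕ) :
    lieSeries H (d + 1) (S * T) =
      S * lieSeries H (d + 1) T + ((2 : ℂ)⁻¹ • rightLie H S) * lieSeries H d T := by
  rw [lieSeries_apply, lieSeries_apply, lieSeries_apply, Finset.sum_range_succ',
    Finset.sum_range_succ' _ (d + 1)]
  simp only [rightLie_pow_succ_mul hS, smul_add, Finset.sum_add_distrib, mul_add S, Finset.mul_sum,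
    mul_smul_comm, smul_mul_assoc, smul_smul]
  have hcoef : ∀ k : ℕ, ((2 : ℂ) ^ (k + 1) * ((k + 1).factorial : ℂ))⁻¹ * ((k : ℂ) + 1) =
      2⁻¹ * ((2 : ℂ) ^ k * (k.factorial : ℂ))⁻¹ := by
    intro k
    have h1 : (k.factorial : ℂ) ≠ 0 := by exact_mod_cast k.factorial_ne_zero
    have h2 : (k : ℂ) + 1 ≠ 0 := by exact_mod_cast k.succ_ne_zero
    rw [Nat.factorial_succ]
    push_cast
    field_simp
    ring
  simp only [hcoef, pow_zero, Module.End.one_apply, mul_comm _ (2⁻¹ : ℂ)]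
  abel

theorem lieSeries_one (H : A) (d : ℕ) : lieSeries H d 1 = 1 := by
  have h : ∀ k, (rightLie H ^ (k + 1)) (1 : A) = 0 := by
    intro k
    rw [pow_succ, Module.End.mul_apply, rightLie_apply, Ring.lie_def, one_mul, mul_one, sub_self,
      map_zero]
  rw [lieSeries_apply, Finset.sum_range_succ']
  simp [h]

/-- Each letter consumes at most one commutator, so for a word of length at most `d` the truncation
loses nothing. -/
theorem lieSeries_word {H : A} {h g : ι → A} (hh : ∀ i, rightLie H (h i) = -((2 : ℂ) • g i))
    (hg : ∀ i, rightLie H (g i) = 0) (l : List ι) {d : ℕ} (hd : l.length ≤ d) :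
    lieSeries H d (l.map h).prod = (l.map fun i => h i - g i).prod := by
  induction l generalizing d with
  | nil => simp [lieSeries_one]
  | cons i l ih =>
    obtain ⟨d, rfl⟩ : ∃ e, d = e + 1 := ⟨d - 1, by simp at hd; omega⟩
    simp only [List.length_cons, add_le_add_iff_right] at hd
    simp only [List.map_cons, List.prod_cons]
    rw [lieSeries_succ_mul (by rw [hh, map_neg, map_smul, hg, smul_zero, neg_zero]), ih hd,
      ih (by omega), hh, smul_neg, smul_smul, sub_mul]
    norm_num
    abel

theorem lieSeries_lift {H : A} {h g : ι → A} (hh : ∀ i, rightLie H (h i) = -((2 : ℂ) • g i))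
    (hg : ∀ i, rightLie H (g i) = 0) {d : ℕ} {P : FreeAlgebra ℂ ι}
    (hP : P ∈ Submodule.span ℂ
      {w | ∃ l : List ι, l.length ≤ d ∧ w = (l.map (FreeAlgebra.ι ℂ)).prod}) :
    lieSeries H d (FreeAlgebra.lift ℂ h P) = FreeAlgebra.lift ℂ (fun i => h i - g i) P := by
  induction hP using Submodule.span_induction with
  | mem P hP =>
    obtain ⟨l, hl, rfl⟩ := hP
    rw [lift_word, lift_word, lieSeries_word hh hg l hl]
  | zero => simp
  | add P Q _ _ hP hQ => simp only [map_add, hP, hQ]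
  | smul r P _ hP => simp only [map_smul, hP]

end LieSeries

/-! ### Passing to invariant functions -/

theorem harmonicSeries_eq_lieSeries (m : ℂ) (d : ℕ) (T : Op N) :
    harmonicSeries m d T = lieSeries (rationalCM N m) d T := by
  rw [lieSeries_apply, harmonicSeries]
  refine Finset.sum_congr rfl (fun k _ => ?_)
  rw [Module.End.pow_apply]
  rfl

/-- A rational function that is invariant under all permutations of the variables. -/
def IsInvariant (f : RatFun N) : Prop := ∀ σ, permOp σ f = f

/-- An operator that commutes with all permutations of the variables. -/
def IsEquivariant (A : Op N) : Prop := ∀ σ, permOp σ * A = A * permOp σ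

theorem IsEquivariant.apply {A : Op N} (hA : IsEquivariant A) {f : RatFun N}
    (hf : IsInvariant f) : IsInvariant (A f) := fun σ => by
  have h := LinearMap.congr_fun (hA σ) f
  rw [Module.End.mul_apply, Module.End.mul_apply, hf σ] at h
  exact h

theorem isInvariant_algebraMap {p : Poly N} (hp : p.IsSymmetric) :
    IsInvariant (algebraMap (Poly N) (RatFun N) p) := fun σ => by
  rw [permOp_algebraMap, hp σ]

theorem IsEquivariant.rightLie {H A : Op N} (hH : IsEquivariant H) (hA : IsEquivariant A) :
    IsEquivariant (rightLie H A) := fun σ => by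
  have h1 := hH σ
  have h2 := hA σ
  rw [rightLie_apply, Ring.lie_def, mul_sub, sub_mul, ← mul_assoc, h2, mul_assoc, h1, ← mul_assoc,
    ← mul_assoc, h1, mul_assoc, mul_assoc, mul_assoc, h2]

/-- Lets `L` and `ℒ_p` be replaced by the Dunkl Laplacian and `P(π)`. Equivariance of the latter
keeps every intermediate function invariant, so agreement on invariants passes to iterated
commutators. -/
theorem lieSeries_apply_congr {L H S A : Op N} (hH : IsEquivariant H) (hA : IsEquivariant A)
    (hL : ∀ f, IsInvariant f → L f = H f) (hS : ∀ f, IsInvariant f → S f = A f) (d : ℕ)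
    {f : RatFun N} (hf : IsInvariant f) : lieSeries L d S f = lieSeries H d A f := by
  have key : ∀ k, IsEquivariant ((rightLie H ^ k) A) ∧
      ∀ f, IsInvariant f → (rightLie L ^ k) S f = (rightLie H ^ k) A f := by
    intro k
    induction k with
    | zero => exact ⟨hA, hS⟩
    | succ k ih =>
      rw [pow_succ', pow_succ', Module.End.mul_apply, Module.End.mul_apply]
      refine ⟨hH.rightLie ih.1, fun f hf => ?_⟩
      simp only [rightLie_apply, Ring.lie_def, LinearMap.sub_apply, Module.End.mul_apply]
      rw [hL f hf, ih.2 f hf, ih.2 _ (hH.apply hf), hL _ (ih.1.apply hf)]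
  rw [lieSeries_apply, lieSeries_apply, LinearMap.sum_apply, LinearMap.sum_apply]
  refine Finset.sum_congr rfl (fun k _ => ?_)
  rw [LinearMap.smul_apply, LinearMap.smul_apply, (key k).2 f hf]

theorem isEquivariant_lift_polychronakos (m : ℂ) {P : FreeAlgebra ℂ (Fin N)}
    (hP : ∀ σ : Equiv.Perm (Fin N),
      FreeAlgebra.lift ℂ (fun i => FreeAlgebra.ι ℂ (σ i)) P = P) :
    IsEquivariant (FreeAlgebra.lift ℂ (polychronakos m) P) := fun σ => by
  rw [perm_mul_lift (permOp_mul_polychronakos m), hP]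

theorem isEquivariant_lift_harmonicPolychronakos (m : ℂ) {P : FreeAlgebra ℂ (Fin N)}
    (hP : ∀ σ : Equiv.Perm (Fin N),
      FreeAlgebra.lift ℂ (fun i => FreeAlgebra.ι ℂ (σ i)) P = P) :
    IsEquivariant (FreeAlgebra.lift ℂ (harmonicPolychronakos m) P) := fun σ => by
  rw [perm_mul_lift (permOp_mul_harmonicPolychronakos m), hP]

/-- The sum of all permutations. -/
def symmetrizer (N : ℕ) : Op N := ∑ σ : Equiv.Perm (Fin N), permOp σ

theorem symmetrizer_mul_permOp (σ : Equiv.Perm (Fin N)) :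
    symmetrizer N * permOp σ = symmetrizer N := by
  unfold symmetrizer
  rw [Finset.sum_mul]
  exact Finset.sum_equiv (Equiv.mulRight σ) (by simp) (by simp [permOp_mul])

theorem permOp_mul_symmetrizer (σ : Equiv.Perm (Fin N)) :
    permOp σ * symmetrizer N = symmetrizer N := by
  unfold symmetrizer
  rw [Finset.mul_sum]
  exact Finset.sum_equiv (Equiv.mulLeft σ) (by simp) (by simp [permOp_mul])

theorem symmetrizer_apply {f : RatFun N} (hf : IsInvariant f) :
    symmetrizer N f = ((Fintype.card (Equiv.Perm (Fin N)) : ℕ) : ℂ) • f := by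
  simp only [symmetrizer, LinearMap.sum_apply, hf _, Finset.sum_const, Finset.card_univ]
  rw [Nat.cast_smul_eq_nsmul]

theorem lift_harmonicPolychronakos_comm (m : ℂ) {P Q : FreeAlgebra ℂ (Fin N)}
    (hP : ∀ σ : Equiv.Perm (Fin N),
      FreeAlgebra.lift ℂ (fun i => FreeAlgebra.ι ℂ (σ i)) P = P)
    (hQ : ∀ σ : Equiv.Perm (Fin N),
      FreeAlgebra.lift ℂ (fun i => FreeAlgebra.ι ℂ (σ i)) Q = Q)
    {f : RatFun N} (hf : IsInvariant f) :
    FreeAlgebra.lift ℂ (harmonicPolychronakos m) P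
        (FreeAlgebra.lift ℂ (harmonicPolychronakos m) Q f) =
      FreeAlgebra.lift ℂ (harmonicPolychronakos m) Q
        (FreeAlgebra.lift ℂ (harmonicPolychronakos m) P f) := by
  have hc0 : ((Fintype.card (Equiv.Perm (Fin N)) : ℕ) : ℂ) ≠ 0 := by
    exact_mod_cast Fintype.card_ne_zero
  have hee : symmetrizer N * symmetrizer N =
      ((Fintype.card (Equiv.Perm (Fin N)) : ℕ) : ℂ) • symmetrizer N := by
    nth_rewrite 1 [symmetrizer]
    rw [Finset.sum_mul]
    simp only [permOp_mul_symmetrizer, Finset.sum_const, Finset.card_univ]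
    rw [Nat.cast_smul_eq_nsmul]
  have h := spherical_commute (permOp_mul_harmonicPolychronakos m)
    (harmonicPolychronakos_comm m) symmetrizer_mul_permOp permOp_mul_symmetrizer
    (fun a ha => by
      unfold symmetrizer
      rw [Finset.sum_mul, Finset.mul_sum]
      exact Finset.sum_congr rfl fun σ _ => ha σ) hc0 hee hP hQ
  have h' := LinearMap.congr_fun h f
  simp only [Module.End.mul_apply, symmetrizer_apply hf, map_smul] at h'
  exact smul_right_injective _ hc0 h'

/-! ### Differential operators depending polynomially on the parameter -/

theorem coord_mem_diffOps (i : Fin N) : mulOp (coord i) ∈ diffOps N :=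
  Algebra.subset_adjoin (Or.inl (Or.inl ⟨i, rfl⟩))

theorem inv_mem_diffOps {i j : Fin N} (h : i ≠ j) : mulOp (coord i - coord j)⁻¹ ∈ diffOps N :=
  Algebra.subset_adjoin (Or.inl (Or.inr ⟨i, j, h, rfl⟩))

theorem partialD_mem_diffOps (i : Fin N) : partialD i ∈ diffOps N :=
  Algebra.subset_adjoin (Or.inr ⟨i, rfl⟩)

theorem conj_mem_diffOps (σ : Equiv.Perm (Fin N)) {A : Op N} (hA : A ∈ diffOps N) :
    permOp σ * A * permOp σ⁻¹ ∈ diffOps N := by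
  have hmul : ∀ f : RatFun N, permOp σ * mulOp f * permOp σ⁻¹ = mulOp (permOp σ f) := fun f => by
    rw [permOp_mul_mulOp, mul_assoc, permOp_mul_inv, mul_one]
  induction hA using Algebra.adjoin_induction with
  | mem A hA =>
    rcases hA with (⟨i, rfl⟩ | ⟨i, j, hij, rfl⟩) | ⟨i, rfl⟩
    · simp only [hmul, permOp_coord]; exact coord_mem_diffOps _
    · rw [hmul, permOp_inv_apply, map_sub, permOp_coord, permOp_coord]
      exact inv_mem_diffOps (σ.injective.ne hij)
    · simp only [permOp_mul_partialD]
      rw [mul_assoc, permOp_mul_inv, mul_one]; exact partialD_mem_diffOps _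
  | algebraMap r =>
    rw [← Algebra.commutes, mul_assoc, permOp_mul_inv, mul_one]
    exact Subalgebra.algebraMap_mem _ r
  | add A B _ _ hA hB => rw [mul_add, add_mul]; exact add_mem hA hB
  | mul A B _ _ hA hB =>
    have e : permOp σ * (A * B) * permOp σ⁻¹ =
        (permOp σ * A * permOp σ⁻¹) * (permOp σ * B * permOp σ⁻¹) := by
      calc _ = permOp σ * A * 1 * B * permOp σ⁻¹ := by simp only [mul_one, mul_assoc]
        _ = _ := by rw [← permOp_inv_mul σ]; simp only [mul_assoc]
    rw [e]; exact mul_mem hA hB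

/-- Families of differential operators depending polynomially on a parameter. -/
def polyFamily (N : ℕ) : Subalgebra ℂ (ℂ → Op N) :=
  (Submodule.span ℂ {B : ℂ → Op N | ∃ k : ℕ, ∃ A ∈ diffOps N, B = fun m => m ^ k • A}).toSubalgebra
    (Submodule.subset_span ⟨0, 1, one_mem _, by ext; simp⟩)
    (fun B B' hB hB' => by
      have h := Submodule.mul_mem_mul hB hB'
      rw [Submodule.span_mul_span] at h
      refine Submodule.span_mono ?_ h
      rintro _ ⟨_, ⟨k, A, hA, rfl⟩, _, ⟨l, A', hA', rfl⟩, rfl⟩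
      refine ⟨k + l, A * A', mul_mem hA hA', ?_⟩
      funext m
      simp only [Pi.mul_apply, smul_mul_smul_comm, pow_add])

theorem smul_mem_polyFamily (k : ℕ) {A : Op N} (hA : A ∈ diffOps N) :
    (fun m : ℂ => m ^ k • A) ∈ polyFamily N :=
  Submodule.subset_span ⟨k, A, hA, rfl⟩

theorem const_mem_polyFamily {A : Op N} (hA : A ∈ diffOps N) :
    (fun _ : ℂ => A) ∈ polyFamily N := by
  simpa using smul_mem_polyFamily 0 hA

theorem polyFamily_induction {p : (ℂ → Op N) → Prop}
    (hmem : ∀ (k : ℕ), ∀ A ∈ diffOps N, p fun m => m ^ k • A) (hzero : p 0)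
    (hadd : ∀ B B', p B → p B' → p (B + B')) (hsmul : ∀ (r : ℂ) B, p B → p (r • B))
    {B : ℂ → Op N} (hB : B ∈ polyFamily N) : p B := by
  change B ∈ Submodule.span ℂ _ at hB
  induction hB using Submodule.span_induction with
  | mem B h => obtain ⟨k, A, hA, rfl⟩ := h; exact hmem k A hA
  | zero => exact hzero
  | add B B' h h' hB hB' => exact hadd B B' hB hB'
  | smul r B h hB => exact hsmul r B hB

theorem exists_coeff_of_mem_polyFamily {B : ℂ → Op N} (hB : B ∈ polyFamily N) :
    ∃ (n : ℕ) (C : ℕ → Op N), (∀ k, C k ∈ diffOps N) ∧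
      ∀ m, B m = ∑ k ∈ Finset.range n, m ^ k • C k := by
  obtain ⟨C, hC, hCB⟩ : ∃ C : ℕ →₀ Op N, (∀ k, C k ∈ diffOps N) ∧
      ∀ m, B m = C.sum fun k A => m ^ k • A := by
    refine polyFamily_induction (p := fun B => ∃ C : ℕ →₀ Op N, (∀ k, C k ∈ diffOps N) ∧
      ∀ m, B m = C.sum fun k A => m ^ k • A) ?_ ?_ ?_ ?_ hB
    · intro k A hA
      refine ⟨Finsupp.single k A, fun l => ?_, fun m => by simp⟩
      rw [Finsupp.single_apply]
      split_ifs
      exacts [hA, zero_mem _]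
    · exact ⟨0, fun _ => zero_mem _, fun m => by simp⟩
    · rintro B B' ⟨C, hC, hB⟩ ⟨C', hC', hB'⟩
      refine ⟨C + C', fun k => add_mem (hC k) (hC' k), fun m => ?_⟩
      rw [Finsupp.sum_add_index' (by simp) (by simp), Pi.add_apply, hB, hB']
    · rintro r B ⟨C, hC, hB⟩
      refine ⟨r • C, fun k => Subalgebra.smul_mem _ (hC k) r, fun m => ?_⟩
      rw [Finsupp.sum_smul_index' (by simp), Pi.smul_apply, hB, Finsupp.smul_sum]
      exact Finset.sum_congr rfl fun k _ => smul_comm _ _ _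
  refine ⟨C.support.sup id + 1, C, hC, fun m => ?_⟩
  rw [hCB m]
  refine Finsupp.sum_of_support_subset _ (fun k hk => ?_) _ (by simp)
  rw [Finset.mem_range, Nat.lt_succ_iff]
  exact Finset.le_sup (f := id) hk

theorem apply_mem_diffOps {B : ℂ → Op N} (hB : B ∈ polyFamily N) (m : ℂ) : B m ∈ diffOps N := by
  obtain ⟨n, C, hC, h⟩ := exists_coeff_of_mem_polyFamily hB
  rw [h]
  exact sum_mem fun k _ => Subalgebra.smul_mem _ (hC k) _

theorem conj_mem_polyFamily (σ : Equiv.Perm (Fin N)) {B : ℂ → Op N} (hB : B ∈ polyFamily N) :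
    (fun m => permOp σ * B m * permOp σ⁻¹) ∈ polyFamily N := by
  refine polyFamily_induction
    (p := fun B => (fun m => permOp σ * B m * permOp σ⁻¹) ∈ polyFamily N) ?_ ?_ ?_ ?_ hB
  · intro k A hA
    simp only [mul_smul_comm, smul_mul_assoc]
    exact smul_mem_polyFamily k (conj_mem_diffOps σ hA)
  · simp only [Pi.zero_apply, mul_zero, zero_mul]
    exact zero_mem (polyFamily N)
  · intro B B' h h'
    simp only [Pi.add_apply, mul_add, add_mul]
    exact add_mem h h'
  · intro r B h
    simp only [Pi.smul_apply, mul_smul_comm, smul_mul_assoc]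
    exact Subalgebra.smul_mem _ h r

theorem param_smul_mem_polyFamily {B : ℂ → Op N} (hB : B ∈ polyFamily N) :
    (fun m => m • B m) ∈ polyFamily N := by
  have h := mul_mem (smul_mem_polyFamily 1 (one_mem (diffOps N))) hB
  convert h using 2 with m
  simp

/-- The restriction of `π_i B` to invariants, for a differential operator `B`. -/
def polychronakosRestrict (i : Fin N) (B : ℂ → Op N) (m : ℂ) : Op N :=
  mulOp (coord i) * (partialD i * B m + m • ∑ j ∈ Finset.univ.erase i,
    mulOp (coord i - coord j)⁻¹ *
      (permOp (Equiv.swap i j) * B m * permOp (Equiv.swap i j)⁻¹ - B m))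

theorem polychronakosRestrict_mem (i : Fin N) {B : ℂ → Op N} (hB : B ∈ polyFamily N) :
    polychronakosRestrict i B ∈ polyFamily N := by
  have h1 : ∀ j ∈ Finset.univ.erase i, (fun m => mulOp (coord i - coord j)⁻¹ *
      (permOp (Equiv.swap i j) * B m * permOp (Equiv.swap i j)⁻¹ - B m)) ∈ polyFamily N :=
    fun j hj => mul_mem (const_mem_polyFamily (inv_mem_diffOps (Finset.ne_of_mem_erase hj).symm))
      (sub_mem (conj_mem_polyFamily _ hB) hB)
  have h2 := param_smul_mem_polyFamily (sum_mem h1)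
  simp only [Finset.sum_apply] at h2
  exact mul_mem (const_mem_polyFamily (coord_mem_diffOps i))
    (add_mem (mul_mem (const_mem_polyFamily (partialD_mem_diffOps i)) hB) h2)

theorem polychronakosRestrict_apply (i : Fin N) (B : ℂ → Op N) (m : ℂ) {f : RatFun N}
    (hf : IsInvariant f) : polychronakosRestrict i B m f = polychronakos m i (B m f) := by
  simp only [polychronakosRestrict, polychronakos, dunkl, Module.End.mul_apply,
    LinearMap.add_apply, LinearMap.smul_apply, LinearMap.sum_apply, LinearMap.sub_apply,
    Module.End.one_apply, hf _]

/-- For invariant `f`, `s_ij B f = (s_ij B s_ij⁻¹) f`, and conjugation preserves differential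
operators. So each letter `π_i` acts on `B f` through a new family, and allowing a general `B` makes
products a matter of iteration. -/
theorem exists_polyFamily_restrict (P : FreeAlgebra ℂ (Fin N)) {B : ℂ → Op N}
    (hB : B ∈ polyFamily N) : ∃ B' ∈ polyFamily N, ∀ m f, IsInvariant f →
      B' m f = FreeAlgebra.lift ℂ (polychronakos m) P (B m f) := by
  induction P using FreeAlgebra.induction generalizing B with
  | grade0 r =>
    refine ⟨r • B, Subalgebra.smul_mem _ hB r, fun m f _ => ?_⟩
    simp [Module.algebraMap_end_apply]
  | grade1 i =>
    refine ⟨_, polychronakosRestrict_mem i hB, fun m f hf => ?_⟩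
    rw [polychronakosRestrict_apply i B m hf, FreeAlgebra.lift_ι_apply]
  | mul P Q hP hQ =>
    obtain ⟨B₁, h₁, e₁⟩ := hQ hB
    obtain ⟨B₂, h₂, e₂⟩ := hP h₁
    refine ⟨B₂, h₂, fun m f hf => ?_⟩
    rw [e₂ m f hf, e₁ m f hf, map_mul, Module.End.mul_apply]
  | add P Q hP hQ =>
    obtain ⟨B₁, h₁, e₁⟩ := hP hB
    obtain ⟨B₂, h₂, e₂⟩ := hQ hB
    refine ⟨B₁ + B₂, add_mem h₁ h₂, fun m f hf => ?_⟩
    rw [Pi.add_apply, LinearMap.add_apply, e₁ m f hf, e₂ m f hf, map_add, LinearMap.add_apply]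

theorem IsTrigIntegral.unique {m : ℂ} {P : FreeAlgebra ℂ (Fin N)} {S T : Op N}
    (hS : IsTrigIntegral m P S) (hT : IsTrigIntegral m P T) : S = T :=
  diffOps_ext hS.mem_diffOps hT.mem_diffOps fun p hp => by
    rw [hS.apply_symmetric p hp, hT.apply_symmetric p hp]

/-- The operators `ℒ_p` form a polynomial family and act on all invariant rational functions. -/
theorem exists_polyFamily_isTrigIntegral {P : FreeAlgebra ℂ (Fin N)}
    (hP : ∀ σ : Equiv.Perm (Fin N),
      FreeAlgebra.lift ℂ (fun i => FreeAlgebra.ι ℂ (σ i)) P = P) :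
    ∃ B ∈ polyFamily N, ∀ m, IsTrigIntegral m P (B m) ∧
      ∀ f, IsInvariant f → B m f = FreeAlgebra.lift ℂ (polychronakos m) P f := by
  obtain ⟨B, hB, h⟩ := exists_polyFamily_restrict P (one_mem (polyFamily N))
  simp only [Pi.one_apply, Module.End.one_apply] at h
  refine ⟨B, hB, fun m => ⟨⟨apply_mem_diffOps hB m, fun σ => ?_, fun p hp =>
    h m _ (isInvariant_algebraMap hp)⟩, h m⟩⟩
  -- Both sides are differential operators that agree on symmetric polynomials, because `P(π)`
  -- preserves invariance.
  have e : permOp σ * B m * permOp σ⁻¹ = B m := by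
    refine diffOps_ext (conj_mem_diffOps σ (apply_mem_diffOps hB m)) (apply_mem_diffOps hB m)
      fun p hp => ?_
    have hp' := isInvariant_algebraMap hp
    rw [Module.End.mul_apply, Module.End.mul_apply, hp' σ⁻¹, h m _ hp',
      (isEquivariant_lift_polychronakos m hP).apply hp']
  nth_rewrite 2 [← e]
  rw [mul_assoc, permOp_inv_mul, mul_one]

/-- By uniqueness `T` is the constructed operator, whose action is known on all invariant rational
functions. This is needed since the commutator series applies `T` to functions such as `L f`. -/
theorem IsTrigIntegral.apply_invariant {m : ℂ} {P : FreeAlgebra ℂ (Fin N)} {T : Op N}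
    (hP : ∀ σ : Equiv.Perm (Fin N),
      FreeAlgebra.lift ℂ (fun i => FreeAlgebra.ι ℂ (σ i)) P = P)
    (hT : IsTrigIntegral m P T) {f : RatFun N} (hf : IsInvariant f) :
    T f = FreeAlgebra.lift ℂ (polychronakos m) P f := by
  obtain ⟨B, _, h⟩ := exists_polyFamily_isTrigIntegral hP
  rw [hT.unique (h m).1, (h m).2 f hf]

theorem rationalCM_mem_polyFamily : rationalCM N ∈ polyFamily N := by
  have h1 : (fun _ : ℂ => ∑ i : Fin N, partialD i ^ 2) ∈ polyFamily N :=
    const_mem_polyFamily (sum_mem fun i _ => pow_mem (partialD_mem_diffOps i) 2)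
  have h2 : (fun m : ℂ => m ^ 1 • ∑ i : Fin N, ∑ j ∈ Finset.Ioi i,
      (2 : ℂ) • (mulOp (coord i - coord j)⁻¹ * (partialD i - partialD j))) ∈ polyFamily N :=
    smul_mem_polyFamily 1 (sum_mem fun i _ => sum_mem fun j hj => Subalgebra.smul_mem _
      (mul_mem (inv_mem_diffOps (Finset.mem_Ioi.mp hj).ne)
        (sub_mem (partialD_mem_diffOps i) (partialD_mem_diffOps j))) 2)
  convert sub_mem h1 h2 using 1
  funext m
  simp only [rationalCM, Pi.sub_apply, Finset.smul_sum, smul_smul, pow_one, mul_comm m 2]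

theorem harmonicCM_mem_diffOps (m : ℂ) : harmonicCM N m ∈ diffOps N :=
  sub_mem (apply_mem_diffOps rationalCM_mem_polyFamily m)
    (sum_mem fun i _ => mul_mem (coord_mem_diffOps i) (partialD_mem_diffOps i))

theorem harmonicSeries_mem_polyFamily (d : ℕ) {B : ℂ → Op N} (hB : B ∈ polyFamily N) :
    (fun m => harmonicSeries m d (B m)) ∈ polyFamily N := by
  have key : ∀ k, (fun m => (rightLie (rationalCM N m) ^ k) (B m)) ∈ polyFamily N := by
    intro k
    induction k with
    | zero => exact hB
    | succ k ih =>
      simp only [pow_succ', Module.End.mul_apply]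
      exact sub_mem (mul_mem ih rationalCM_mem_polyFamily) (mul_mem rationalCM_mem_polyFamily ih)
  have h := sum_mem fun k (_ : k ∈ Finset.range (d + 1)) =>
    Subalgebra.smul_mem _ (key k) ((2 : ℂ) ^ k * (k.factorial : ℂ))⁻¹
  convert h using 1
  funext m
  rw [harmonicSeries_eq_lieSeries, lieSeries_apply, Finset.sum_apply]
  rfl

theorem harmonicSeries_mem_diffOps (m : ℂ) (d : ℕ) {T : Op N} (hT : T ∈ diffOps N) :
    harmonicSeries m d T ∈ diffOps N :=
  apply_mem_diffOps (harmonicSeries_mem_polyFamily d (const_mem_polyFamily hT)) m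

/-- The bridge between the two halves of the argument: on invariants the series for `ℒ_p` is `P`
evaluated at the `h_i`. -/
theorem harmonicSeries_apply_invariant {m : ℂ} {p : Poly N} {P : FreeAlgebra ℂ (Fin N)}
    {T : Op N} (hP : IsSymmetricOrdering p P) (hT : IsTrigIntegral m P T) {f : RatFun N}
    (hf : IsInvariant f) : harmonicSeries m p.totalDegree T f =
      FreeAlgebra.lift ℂ (harmonicPolychronakos m) P f := by
  rw [harmonicSeries_eq_lieSeries, lieSeries_apply_congr (H := dunklLaplacian N m)
    (permOp_mul_dunklLaplacian m) (isEquivariant_lift_polychronakos m hP.invariant)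
    (fun f hf => (dunklLaplacian_apply_invariant m hf).symm)
    (fun f hf => hT.apply_invariant hP.invariant hf) _ hf,
    lieSeries_lift (polychronakos_lie m) (dunkl_sq_lie m) hP.degree_le]
  rfl

/-! ### Orderings of symmetric polynomials -/

theorem exists_isSymmetricOrdering {p : Poly N} (hp : p.IsSymmetric) :
    ∃ P, IsSymmetricOrdering p P := by
  set W := Submodule.span ℂ
    {w | ∃ l : List (Fin N), l.length ≤ p.totalDegree ∧ w = (l.map (FreeAlgebra.ι ℂ)).prod}
  let act : Equiv.Perm (Fin N) → FreeAlgebra ℂ (Fin N) →ₐ[ℂ] FreeAlgebra ℂ (Fin N) :=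
    fun σ => FreeAlgebra.lift ℂ (fun i => FreeAlgebra.ι ℂ (σ i))
  have act_mul : ∀ σ τ P, act σ (act τ P) = act (σ * τ) P := by
    intro σ τ P
    have : (act σ).comp (act τ) = act (σ * τ) := by
      ext i
      simp [act]
    exact DFunLike.congr_fun this P
  have act_word : ∀ σ (l : List (Fin N)),
      act σ (l.map (FreeAlgebra.ι ℂ)).prod = ((l.map σ).map (FreeAlgebra.ι ℂ)).prod := by
    intro σ l
    rw [lift_word, List.map_map]
    rfl
  have act_mem : ∀ σ P, P ∈ W → act σ P ∈ W := by
    intro σ P hP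
    induction hP using Submodule.span_induction with
    | mem P h =>
      obtain ⟨l, hl, rfl⟩ := h
      rw [act_word]
      exact Submodule.subset_span ⟨l.map σ, by simpa using hl, rfl⟩
    | zero => rw [map_zero]; exact zero_mem _
    | add P Q _ _ hP hQ => rw [map_add]; exact add_mem hP hQ
    | smul r P _ hP => rw [map_smul]; exact Submodule.smul_mem _ _ hP
  have act_image : ∀ σ P, FreeAlgebra.lift ℂ (fun i => (X i : Poly N)) (act σ P) =
      rename σ (FreeAlgebra.lift ℂ (fun i => (X i : Poly N)) P) := by
    intro σ P
    have : (FreeAlgebra.lift ℂ (fun i => (X i : Poly N))).comp (act σ) =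
        (rename σ).comp (FreeAlgebra.lift ℂ (fun i => (X i : Poly N))) := by
      ext i
      simp [act]
    exact DFunLike.congr_fun this P
  obtain ⟨P₀, hP₀, himg⟩ : ∃ P₀ ∈ W, FreeAlgebra.lift ℂ (fun i => (X i : Poly N)) P₀ = p := by
    refine ⟨∑ d ∈ p.support,
      p.coeff d • ((Finsupp.toMultiset d).toList.map (FreeAlgebra.ι ℂ)).prod, ?_, ?_⟩
    · refine sum_mem fun d hd => Submodule.smul_mem _ _ (Submodule.subset_span ⟨_, ?_, rfl⟩)
      rw [Multiset.length_toList, Finsupp.card_toMultiset]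
      exact le_totalDegree hd
    · rw [map_sum]
      conv_rhs => rw [p.as_sum]
      refine Finset.sum_congr rfl fun d _ => ?_
      rw [map_smul, lift_word, ← Multiset.prod_coe, ← Multiset.map_coe, Multiset.coe_toList,
        Finset.prod_multiset_map_count, Finsupp.toFinset_toMultiset, monomial_eq, smul_eq_C_mul]
      simp only [Finsupp.count_toMultiset]
      rfl
  have hc0 : ((Fintype.card (Equiv.Perm (Fin N)) : ℕ) : ℂ) ≠ 0 := by
    exact_mod_cast Fintype.card_ne_zero
  -- Average an arbitrary ordering of the monomials over the group; the commutative image is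
  -- unchanged because `p` is symmetric.
  refine ⟨((Fintype.card (Equiv.Perm (Fin N)) : ℕ) : ℂ)⁻¹ • ∑ σ, act σ P₀, ?_, ?_, ?_⟩
  · intro σ
    change act σ _ = _
    rw [map_smul, map_sum]
    simp only [act_mul]
    congr 1
    exact Finset.sum_equiv (Equiv.mulLeft σ) (by simp) (by simp)
  · rw [map_smul, map_sum]
    simp only [act_image, himg, hp _, Finset.sum_const, Finset.card_univ]
    rw [← Nat.cast_smul_eq_nsmul ℂ, smul_smul, inv_mul_cancel₀ hc0, one_smul]
  · exact Submodule.smul_mem _ _ (sum_mem fun σ _ => act_mem σ _ hP₀)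

/-- In degree at most 1 there is nothing to order: the constant and linear coefficients are read off
from the commutative image. -/
theorem eq_sum_of_isSymmetricOrdering_psum_one {P : FreeAlgebra ℂ (Fin N)}
    (hP : IsSymmetricOrdering (psum (Fin N) ℂ 1) P) : P = ∑ i, FreeAlgebra.ι ℂ i := by
  -- Only an inequality, since the degree is 0 when `N = 0`.
  have hdeg : (psum (Fin N) ℂ 1).totalDegree ≤ 1 := by
    rw [psum_one]
    exact totalDegree_finsetSum_le fun i _ => by simp
  obtain ⟨c, a, rfl⟩ : ∃ (c : ℂ) (a : Fin N → ℂ),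
      P = algebraMap ℂ _ c + ∑ i, a i • FreeAlgebra.ι ℂ i := by
    have hspan := hP.degree_le
    clear hP
    induction hspan using Submodule.span_induction with
    | mem P h =>
      obtain ⟨l, hl, rfl⟩ := h
      rcases l with _ | ⟨i, _ | ⟨j, l⟩⟩
      · exact ⟨1, 0, by simp⟩
      · exact ⟨0, Pi.single i 1, by simp [Pi.single_apply]⟩
      · simp only [List.length_cons] at hl; omega
    | zero => exact ⟨0, 0, by simp⟩
    | add P Q _ _ hP hQ =>
      obtain ⟨c, a, rfl⟩ := hP
      obtain ⟨c', a', rfl⟩ := hQ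
      exact ⟨c + c', a + a', by simp [add_smul, Finset.sum_add_distrib]; abel⟩
    | smul r P _ hP =>
      obtain ⟨c, a, rfl⟩ := hP
      exact ⟨r * c, r • a, by
        simp [Algebra.smul_def, mul_assoc, mul_add, Finset.mul_sum]⟩
  have himg := hP.commutative_image
  simp only [map_add, map_sum, map_smul, FreeAlgebra.lift_ι_apply, AlgHom.commutes, psum_one,
    MvPolynomial.algebraMap_eq] at himg
  have hc : c = 0 := by
    have := congrArg constantCoeff himg
    simpa [smul_eq_C_mul] using this
  have ha : ∀ i, a i = 1 := by
    intro i
    have := congrArg (fun q => constantCoeff (pderiv i q)) himg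
    simpa [smul_eq_C_mul, pderiv_X, Pi.single_apply] using this
  simp [hc, ha]

theorem sum_harmonicPolychronakos_apply (m : ℂ) {f : RatFun N} (hf : IsInvariant f) :
    FreeAlgebra.lift ℂ (harmonicPolychronakos m) (∑ i, FreeAlgebra.ι ℂ i) f =
      -harmonicCM N m f := by
  have h := dunklLaplacian_apply_invariant m hf
  simp only [harmonicCM, LinearMap.sub_apply, ← h, map_sum, FreeAlgebra.lift_ι_apply,
    harmonicPolychronakos, Finset.sum_sub_distrib, dunklLaplacian, LinearMap.sum_apply,
    polychronakos, Module.End.mul_apply, dunkl_apply_invariant m _ hf]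
  abel

end CalogeroMoser

end

/-! ### The main theorem -/

open CalogeroMoser in
theorem corollary5p6 (N : ℕ) :
    -- every symmetric polynomial has an ordering
    (∀ p : Poly N, p.IsSymmetric → ∃ P, IsSymmetricOrdering p P) ∧
    -- the operator `ℒ_p` exists and is unique
    (∀ (m : ℂ) (p : Poly N) (P : FreeAlgebra ℂ (Fin N)), p.IsSymmetric →
      IsSymmetricOrdering p P → ∃! T : Op N, IsTrigIntegral m P T) ∧
    -- the operators `ℒ_p^H` commute
    (∀ (m : ℂ) (p q : Poly N) (P Q : FreeAlgebra ℂ (Fin N)) (S T : Op N),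
      p.IsSymmetric → q.IsSymmetric →
      IsSymmetricOrdering p P → IsSymmetricOrdering q Q →
      IsTrigIntegral m P S → IsTrigIntegral m Q T →
      ⁅harmonicSeries m p.totalDegree S, harmonicSeries m q.totalDegree T⁆ = 0) ∧
    -- they are differential operators which commute with the harmonic Hamiltonian
    (∀ (m : ℂ) (p : Poly N) (P : FreeAlgebra ℂ (Fin N)) (T : Op N),
      p.IsSymmetric → IsSymmetricOrdering p P → IsTrigIntegral m P T →
      harmonicSeries m p.totalDegree T ∈ diffOps N ∧
      ⁅harmonicSeries m p.totalDegree T, harmonicCM N m⁆ = 0) ∧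
    -- which is, up to sign, the member of the family for `p = ξ_1 + ⋯ + ξ_N`
    (∀ (m : ℂ) (P : FreeAlgebra ℂ (Fin N)) (T : Op N),
      IsSymmetricOrdering (MvPolynomial.psum (Fin N) ℂ 1) P → IsTrigIntegral m P T →
      harmonicSeries m (MvPolynomial.psum (Fin N) ℂ 1).totalDegree T = -harmonicCM N m) ∧
    -- the coefficients of `ℒ_p^H` are polynomial in `m`
    (∀ (p : Poly N) (P : FreeAlgebra ℂ (Fin N)), p.IsSymmetric → IsSymmetricOrdering p P →
      ∃ (n : ℕ) (C : ℕ → Op N), (∀ k, C k ∈ diffOps N) ∧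
        ∀ (m : ℂ) (T : Op N), IsTrigIntegral m P T →
          harmonicSeries m p.totalDegree T = ∑ k ∈ Finset.range n, m ^ k • C k) := by
  have hcomm : ∀ (m : ℂ) (p q : Poly N) (P Q : FreeAlgebra ℂ (Fin N)) (S T : Op N),
      IsSymmetricOrdering p P → IsSymmetricOrdering q Q →
      IsTrigIntegral m P S → IsTrigIntegral m Q T →
      ⁅harmonicSeries m p.totalDegree S, harmonicSeries m q.totalDegree T⁆ = 0 := by
    intro m p q P Q S T hP hQ hS hT
    have hS' := harmonicSeries_mem_diffOps m p.totalDegree hS.mem_diffOps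
    have hT' := harmonicSeries_mem_diffOps m q.totalDegree hT.mem_diffOps
    rw [Ring.lie_def, sub_eq_zero]
    refine diffOps_ext (mul_mem hS' hT') (mul_mem hT' hS') fun r hr => ?_
    have hf := isInvariant_algebraMap hr
    have hPf := (isEquivariant_lift_harmonicPolychronakos m hP.invariant).apply hf
    have hQf := (isEquivariant_lift_harmonicPolychronakos m hQ.invariant).apply hf
    rw [Module.End.mul_apply, Module.End.mul_apply, harmonicSeries_apply_invariant hQ hT hf,
      harmonicSeries_apply_invariant hP hS hf, harmonicSeries_apply_invariant hP hS hQf,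
      harmonicSeries_apply_invariant hQ hT hPf,
      lift_harmonicPolychronakos_comm m hP.invariant hQ.invariant hf]
  have hpsum : ∀ (m : ℂ) (P : FreeAlgebra ℂ (Fin N)) (T : Op N),
      IsSymmetricOrdering (MvPolynomial.psum (Fin N) ℂ 1) P → IsTrigIntegral m P T →
      harmonicSeries m (MvPolynomial.psum (Fin N) ℂ 1).totalDegree T = -harmonicCM N m := by
    intro m P T hP hT
    refine diffOps_ext (harmonicSeries_mem_diffOps m _ hT.mem_diffOps)
      (neg_mem (harmonicCM_mem_diffOps m)) fun r hr => ?_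
    have hf := isInvariant_algebraMap hr
    rw [harmonicSeries_apply_invariant hP hT hf, eq_sum_of_isSymmetricOrdering_psum_one hP,
      sum_harmonicPolychronakos_apply m hf, LinearMap.neg_apply]
  refine ⟨fun p hp => exists_isSymmetricOrdering hp, fun m p P _ hP => ?_,
    fun m p q P Q S T _ _ hP hQ hS hT => hcomm m p q P Q S T hP hQ hS hT,
    fun m p P T _ hP hT => ⟨harmonicSeries_mem_diffOps m _ hT.mem_diffOps, ?_⟩, hpsum,
    fun p P _ hP => ?_⟩
  · obtain ⟨B, _, h⟩ := exists_polyFamily_isTrigIntegral hP.invariant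
    exact ⟨B m, (h m).1, fun T hT => hT.unique (h m).1⟩
  -- The Hamiltonian is minus the member of the family for the first power sum, so this is an
  -- instance of commutativity.
  · obtain ⟨Q, hQ⟩ := exists_isSymmetricOrdering (MvPolynomial.psum_isSymmetric (Fin N) ℂ 1)
    obtain ⟨B, _, h⟩ := exists_polyFamily_isTrigIntegral hQ.invariant
    have h' := hcomm m p _ P Q T (B m) hP hQ hT (h m).1
    rw [hpsum m Q _ hQ (h m).1] at h'
    ext f
    have hf := LinearMap.congr_fun h' f
    simp only [Ring.lie_def, LinearMap.sub_apply, Module.End.mul_apply, LinearMap.neg_apply,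
      map_neg, LinearMap.zero_apply] at hf ⊢
    linear_combination -hf
  · obtain ⟨B, hB, h⟩ := exists_polyFamily_isTrigIntegral hP.invariant
    obtain ⟨n, C, hC, e⟩ :=
      exists_coeff_of_mem_polyFamily (harmonicSeries_mem_polyFamily p.totalDegree hB)
    refine ⟨n, C, hC, fun m T hT => ?_⟩
    rw [hT.unique (h m).1, ← e m]
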